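/- **Setting.** A learner interacts for $T$ rounds with an unknown reward function $f:[0,1]\to\mathbb R$. In round $t$ it chooses $x_t\in[0,1]$ (possibly at random) on the basis of the past actions and rewards and receives $y_t=f(x_t)+\varepsilon_t$, where $\varepsilon_1,\varepsilon_2,\dots$ are i.i.d. with a centred law that is $\tfrac14$-subgaussian, i.e. $\mathbb E\,e^{s\varepsilon_t}\le e^{s^2/8}$ for all $s\in\mathbb R$. The regret is $R_T=\sum_{t=1}^T(\max f-f(x_t))$. Worst cases are taken over the reward functions in a ball and over the noise laws in a class $\mathcal S$ of centred $\tfrac14$-subgaussian laws, where $\mathcal S$ is any such class containing the normal law $N(0,\tfrac14)$ (for instance only this law, or all $\tfrac14$-subgaussian laws). Let $0<m_1<m_2$ be integers. For $i=1,2$ let $\kappa_i:\mathbb R\to\mathbb R$ be continuous, integrable and even, with $c_{i}(1+\omega^2)^{-m_i}\le\hat\kappa_i(\omega)\le c_{i}'(1+\omega^2)^{-m_i}$ for all $\omega\in\mathbb R$ and some constants $0<c_i\le c_i'$, and let $\mathcal H_i$ be the reproducing kernel Hilbert space on $[0,1]$ of the kernel $(x,y)\mapsto\kappa_i(x-y)$,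 with ball $\mathcal H_i(B)=\{f\in\mathcal H_i:\|f\|_{\mathcal H_i}\le B\}$. Let $|u|_{m,2}=\|u^{(m)}\|_{L^2(0,1)}$ (weak derivative), and let $W_0^{m,2}(0,1)$ be the closure of $C_c^\infty((0,1))$ in the Sobolev space $W^{m,2}(0,1)$. A number $c_u>0$ is called admissible if, for $i=1,2$, every $u\in W_0^{m_i,2}(0,1)$ lies (through its continuous representative) in $\mathcal H_i$ and $\|u\|_{\mathcal H_i}\le c_u|u|_{m_i,2}$. **Constants.** Let $K_0(x)=e^{-1/(1-x^2)}$ for $|x|<1$ and $K_0(x)=0$ otherwise, $K_0^*=\max K_0$, $I_m=\int_{-1}^1\big(K_0^{(m)}(u)\big)^2du$, and $$C(m)=\Big(\frac{K_0^*}{2^{2m-1}\sqrt{I_m}}\Big)^{\frac1{m-1/2}},\qquad C'(m_1,m_2)=2^{2m_2-2}\Big(\frac{C(m_1)}{32}\Big)^{\frac{m_1-1/2}{m_1+1/2}}\frac{\sqrt{I_{m_2}}}{K_0^*}.$$ **Theorem.** An admissible constant exists. Let $c_u$ be any admissible constant and let $\tilde R>0$. There exist $B_1,B_2>0$ with $$c_u\,\frac{3^{m_1+1/2}}{32}\,C(m_1)^{-m_1+1/2}\,\tilde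 R^{-1}\;\le\; B_1\;\le\; C'(m_1,m_2)^{-(m_1+1/2)}\,c_u^{-m_1+1/2}\,B_2^{\,m_1+1/2}\,\tilde R^{\,m_1-1/2}.\qquad(*)$$ For all $B_1,B_2>0$ satisfying $(*)$, every such class $\mathcal S$, every $T$ and every algorithm: if $$\sup_{f\in\mathcal H_2(B_2)}\mathbb E[R_T]\le\tilde R,$$ then $$\sup_{f\in\mathcal H_1(B_1)}\mathbb E[R_T]\;\ge\;\frac18\Big(\frac{C(m_1)}{32}\Big)^{\frac{m_1-1/2}{m_1+1/2}}\Big(\frac{B_1}{c_u}\Big)^{\frac1{m_1+1/2}}\tilde R^{-\frac{m_1-1/2}{m_1+1/2}}\,T,$$ where both suprema are also taken over the noise laws in $\mathcal S$. -/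

import Mathlib

open MeasureTheory ProbabilityTheory Set Filter Topology
open scoped ENNReal NNReal ContDiff FourierTransform

noncomputable section

namespace KernelBandit

/-! ### Sobolev spaces of integer order on the interval (0,1) -/

/-- Lebesgue measure on the interval `(0,1)`. -/
def unitVolume : Measure ℝ := volume.restrict (Ioo (0 : ℝ) 1)

/-- The test functions `C_c^∞((0,1))`. -/
structure IsTestFunction (φ : ℝ → ℝ) : Prop where
  contDiff : ContDiff ℝ ∞ φ
  hasCompactSupport : HasCompactSupport φ
  tsupport_subset : tsupport φ ⊆ Ioo (0 : ℝ) 1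

/-- `v` is a `k`-th weak derivative of `u` on `(0,1)`. -/
def IsWeakDeriv (k : ℕ) (u v : ℝ → ℝ) : Prop :=
  ∀ φ : ℝ → ℝ, IsTestFunction φ →
    ∫ x, u x * iteratedDeriv k φ x ∂unitVolume = (-1) ^ k * ∫ x, v x * φ x ∂unitVolume

/-- `u ∈ W^{m,2}(0,1)`: `u` and its weak derivatives up to order `m` are in `L²(0,1)`. -/
def MemSobolev (m : ℕ) (u : ℝ → ℝ) : Prop :=
  MemLp u 2 unitVolume ∧
    ∀ k ≤ m, ∃ v : ℝ → ℝ, MemLp v 2 unitVolume ∧ IsWeakDeriv k u v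

open Classical in
/-- The `k`-th weak derivative of `u` in `L²(0,1)` (unique up to null sets when it exists;
`0` by convention when it does not). -/
def weakDeriv (k : ℕ) (u : ℝ → ℝ) : ℝ → ℝ :=
  if h : ∃ v : ℝ → ℝ, MemLp v 2 unitVolume ∧ IsWeakDeriv k u v then h.choose else 0

/-- The seminorm `|u|_{k,2}`, the `L²(0,1)` norm of the `k`-th weak derivative. -/
def sobolevSeminorm (k : ℕ) (u : ℝ → ℝ) : ℝ :=
  Real.sqrt (∫ x, (weakDeriv k u x) ^ 2 ∂unitVolume)

/-- The norm `‖u‖_{m,2}` of `W^{m,2}(0,1)`. -/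
def sobolevNorm (m : ℕ) (u : ℝ → ℝ) : ℝ :=
  Real.sqrt (∑ k ∈ Finset.range (m + 1), ∫ x, (weakDeriv k u x) ^ 2 ∂unitVolume)

/-- `u ∈ W_0^{m,2}(0,1)`, the closure of the test functions in `W^{m,2}(0,1)`. -/
def MemSobolevZero (m : ℕ) (u : ℝ → ℝ) : Prop :=
  MemSobolev m u ∧ ∃ φ : ℕ → ℝ → ℝ, (∀ n, IsTestFunction (φ n)) ∧
    Tendsto (fun n => sobolevNorm m (fun x => u x - φ n x)) atTop (𝓝 0)

/-! ### Translation-invariant kernels and their reproducing kernel Hilbert spaces -/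

/-- `(x, y) ↦ κ (x - y)` is a continuous, integrable, symmetric, real translation-invariant kernel
whose Fourier transform decays at rate `m`. Symmetry makes the Fourier transform real-valued, and
the lower bound makes the kernel positive definite. The frequency here is `1 / (2π)` times the
angular one; this only changes the values of the two constants. -/
structure HasFourierDecay (κ : ℝ → ℝ) (m : ℕ) : Prop where
  continuous : Continuous κ
  integrable : Integrable κ
  even : ∀ x, κ (-x) = κ x
  decay : ∃ c₁ c₂ : ℝ, 0 < c₁ ∧ c₁ ≤ c₂ ∧ ∀ w : ℝ,
    c₁ * ((1 + w ^ 2) ^ m)⁻¹ ≤ (𝓕 (fun x : ℝ => (κ x : ℂ)) w).re ∧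
      (𝓕 (fun x : ℝ => (κ x : ℂ)) w).re ≤ c₂ * ((1 + w ^ 2) ^ m)⁻¹

/-- The reproducing kernel Hilbert space `H` of functions on `[0,1]` is the one of the kernel
`(x, y) ↦ κ (x - y)`. -/
def IsRKHSOf (H : Type*) [NormedAddCommGroup H] [InnerProductSpace ℝ H] [CompleteSpace H]
    [RKHS ℝ H unitInterval ℝ] (κ : ℝ → ℝ) : Prop :=
  ∀ x y : unitInterval, RKHS.kernel H x y 1 = κ ((x : ℝ) - (y : ℝ))

/-- `c` is an upper norm-equivalence constant: every `u ∈ W_0^{m,2}(0,1)` (represented by a function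
that is continuous on `[0,1]`) belongs to the space `H`, and `‖u‖_H ≤ c |u|_{m,2}`. -/
def IsNormEquivUpper (H : Type*) [NormedAddCommGroup H] [InnerProductSpace ℝ H]
    [RKHS ℝ H unitInterval ℝ] (m : ℕ) (c : ℝ) : Prop :=
  ∀ u : ℝ → ℝ, ContinuousOn u (Icc (0 : ℝ) 1) → MemSobolevZero m u →
    ∃ g : H, (∀ x : unitInterval, g x = u x) ∧ ‖g‖ ≤ c * sobolevSeminorm m u

/-! ### The numerical constants -/

/-- The bump function `K₀(x) = exp (-1 / (1 - x²))` for `|x| < 1`, and `0` otherwise. -/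
def bump (x : ℝ) : ℝ := if |x| < 1 then Real.exp (-1 / (1 - x ^ 2)) else 0

/-- The maximum `K₀*` of the bump function. -/
def bumpMax : ℝ := ⨆ x : ℝ, bump x

/-- `I_m = ∫_{-1}^{1} (K₀^{(m)})²`. -/
def bumpEnergy (m : ℕ) : ℝ := ∫ u in (-1 : ℝ)..1, (iteratedDeriv m bump u) ^ 2

/-- The constant `C(m)`. -/
def constC (m : ℕ) : ℝ :=
  (bumpMax / ((2 : ℝ) ^ (2 * (m : ℝ) - 1) * Real.sqrt (bumpEnergy m))) ^ (1 / ((m : ℝ) - 1 / 2))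

/-- The constant `C'(m₁, m₂)`. -/
def constC' (m₁ m₂ : ℕ) : ℝ :=
  (2 : ℝ) ^ (2 * (m₂ : ℝ) - 2) *
    (constC m₁ / 32) ^ (((m₁ : ℝ) - 1 / 2) / ((m₁ : ℝ) + 1 / 2)) *
      (Real.sqrt (bumpEnergy m₂) / bumpMax)

/-- The constraints on the radii `B₁, B₂` of the two balls. -/
structure AdmissibleRadii (m₁ m₂ : ℕ) (cu R B₁ B₂ : ℝ) : Prop where
  pos₁ : 0 < B₁
  pos₂ : 0 < B₂
  lower : cu * ((3 : ℝ) ^ ((m₁ : ℝ) + 1 / 2) / 32 * constC m₁ ^ (-(m₁ : ℝ) + 1 / 2) * R⁻¹) ≤ B₁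
  upper : B₁ ≤ constC' m₁ m₂ ^ (-((m₁ : ℝ) + 1 / 2)) * cu ^ (-(m₁ : ℝ) + 1 / 2) *
    B₂ ^ ((m₁ : ℝ) + 1 / 2) * R ^ ((m₁ : ℝ) - 1 / 2)

/-! ### The bandit problem on [0,1] -/

/-- A centred noise law that is `1/4`-subgaussian (variance proxy `1/4`). -/
structure IsNoiseLaw (ξ : Measure ℝ) : Prop where
  isProbabilityMeasure : IsProbabilityMeasure ξ
  mean_zero : ∫ x, x ∂ξ = 0
  subgaussian : HasSubgaussianMGF (fun x : ℝ => x) (1 / 4) ξ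

/-- A (possibly randomised) bandit algorithm: the conditional law of the next action in `[0,1]`
given the past actions and rewards. -/
structure Algorithm where
  policy : (t : ℕ) → Kernel (Fin t → unitInterval × ℝ) unitInterval
  isMarkovKernel : ∀ t, IsMarkovKernel (policy t)

/-- The law of the first `t` actions and rewards when the reward function is `f` and the noise
variables are independent with law `ξ`: the next action `a` is drawn from the policy given the
history, the noise `e` is drawn independently from `ξ`, and the reward is `f a + e`. -/
def Algorithm.law (π : Algorithm) (f : unitInterval → ℝ) (ξ : Measure ℝ) :
    (t : ℕ) → Measure (Fin t → unitInterval × ℝ)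
  | 0 => Measure.dirac (fun i => i.elim0)
  | t + 1 => (((Algorithm.law π f ξ t) ⊗ₘ (π.policy t)).prod ξ).map
      (fun p => Fin.snoc (α := fun _ => unitInterval × ℝ) p.1.1 (p.1.2, f p.1.2 + p.2))

/-- The expected cumulative pseudo-regret `E[R_T]`. -/
def Algorithm.expectedRegret (π : Algorithm) (f : unitInterval → ℝ) (ξ : Measure ℝ) (T : ℕ) : ℝ :=
  ∫ h, ∑ t : Fin T, ((⨆ a, f a) - f (h t).1) ∂(π.law f ξ T)

/-- The worst-case expected regret over the ball of radius `B` of `H` and the class `S` of noise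
laws. -/
def Algorithm.worstRegret (π : Algorithm) (H : Type*) [NormedAddCommGroup H]
    [InnerProductSpace ℝ H] [RKHS ℝ H unitInterval ℝ] (B : ℝ) (S : Set (Measure ℝ)) (T : ℕ) :
    EReal :=
  ⨆ (f : H) (_ : ‖f‖ ≤ B) (ξ : Measure ℝ) (_ : ξ ∈ S), ((π.expectedRegret f ξ T : ℝ) : EReal)

end KernelBandit

end

/-!
The lower bound is a needle-in-a-haystack argument. Let `D` be `needleHeight`. The base reward `f₀`
is a bump of height `D / 2` filling `[1/2, 1]`; alternatives `f i` add to it one of `K ≈ 32 R D`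
bumps of height `D` with disjoint supports in `[0, 1/2]`. The constraints on the radii say exactly
that `f₀` lies in the smooth ball (`needleHeight_mul_le`), that there is room for at least three
bumps (`three_le_needles`), and that each `f i` lies in the rough ball as soon as `K + 1 ≤ 32 R D`
(`sq_radius_eq`). The norms are those of Sobolev seminorms: by scaling they reduce to `bumpEnergy`,
and a smooth function supported in the closed interval `[0, 1]` belongs to `W_0^{m,2}(0,1)` because
its dilations about `1/2` are test functions converging to it (`memSobolevZero_of_contDiff`).

Regret at most `R` under `f₀` allows only `2 R / D` expected visits to `[0, 1/2]`, hence at most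
`2 R / (D K)` to the least visited bump `i`. For the noise `N(0, 1/4)` the laws of the histories
under `f₀` and `f i` are equivalent with an explicit density (`Algorithm.law_eq_withDensity`), and
their relative entropy, twice the expected sum of squared reward differences, is at most `1/4`.
The Donsker–Varadhan inequality with Hoeffding's lemma (`mul_integral_sub_le`) then transfers to
`f i` the lower bound on the regret that holds for the actions played under `f₀`
(`Algorithm.exists_regret_ge`). The constant `1/8` requires weighing the actions: one that misses
both peaks of `f i` costs `D`, one in `(1/2, 1]` only `D / 2`.

An admissible constant exists because, by Fourier inversion, `∑ a_x φ(x)` is for a test function `φ`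
the pairing of `𝓕 φ` with the exponential sum of `a`, while the squared norm of the corresponding
combination of kernel functions is the integral of `|∑ a_x e^{2πixw}|²` against the transform of the
kernel (Bochner's formula, `HasFourierDecay.quadratic_form_eq`). Cauchy–Schwarz, Plancherel and
Poincaré's inequality bound the former by the latter times `|φ|_{m,2}`; the bound passes to
`W_0^{m,2}(0,1)` by density, and Hahn–Banach with Riesz' theorem turns it into membership in the
space (`exists_mem_rkhs_of_bound`).
-/

namespace KernelBandit

/-! ### Weak derivatives on the unit interval -/

instance : IsProbabilityMeasure unitVolume :=
  ⟨by simp [unitVolume]⟩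

lemma continuous_iteratedDeriv_of_contDiff {u : ℝ → ℝ} (hu : ContDiff ℝ ∞ u) (k : ℕ) :
    Continuous (iteratedDeriv k u) :=
  hu.continuous_iteratedDeriv k (by exact_mod_cast le_top)

lemma contDiff_iteratedDeriv {u : ℝ → ℝ} (hu : ContDiff ℝ ∞ u) (k : ℕ) :
    ContDiff ℝ ∞ (iteratedDeriv k u) := by
  rw [iteratedDeriv_eq_iterate]
  exact hu.iterate_deriv k

lemma support_iteratedDeriv_subset (u : ℝ → ℝ) (k : ℕ) :
    Function.support (iteratedDeriv k u) ⊆ tsupport u := by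
  intro x hx
  apply support_iteratedFDeriv_subset (𝕜 := ℝ) k
  intro h
  apply hx
  simp [iteratedDeriv, h]

lemma integral_unitVolume_eq_intervalIntegral (g : ℝ → ℝ) :
    ∫ x, g x ∂unitVolume = ∫ x in (0 : ℝ)..1, g x := by
  rw [intervalIntegral.integral_of_le zero_le_one, unitVolume, integral_Ioc_eq_integral_Ioo]

lemma memLp_of_continuous {u : ℝ → ℝ} (hu : Continuous u) : MemLp u 2 unitVolume := by
  obtain ⟨M, hM⟩ := isCompact_Icc.exists_bound_of_continuousOn (s := Icc (0 : ℝ) 1) hu.continuousOn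
  refine MemLp.of_bound hu.aestronglyMeasurable M ?_
  exact (ae_restrict_mem measurableSet_Ioo).mono fun x hx => hM x (Ioo_subset_Icc_self hx)

lemma integrable_of_continuous {u : ℝ → ℝ} (hu : Continuous u) : Integrable u unitVolume :=
  (memLp_of_continuous hu).integrable (by norm_num)

namespace IsTestFunction

variable {φ ψ : ℝ → ℝ}

lemma continuous_iteratedDeriv (hφ : IsTestFunction φ) (k : ℕ) :
    Continuous (iteratedDeriv k φ) :=
  continuous_iteratedDeriv_of_contDiff hφ.contDiff k

lemma eq_zero_of_notMem (hφ : IsTestFunction φ) {x : ℝ} (hx : x ∉ Ioo (0 : ℝ) 1) : φ x = 0 :=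
  image_eq_zero_of_notMem_tsupport fun h => hx (hφ.tsupport_subset h)

protected lemma iteratedDeriv (hφ : IsTestFunction φ) (k : ℕ) :
    IsTestFunction (iteratedDeriv k φ) := by
  have h : tsupport (iteratedDeriv k φ) ⊆ tsupport φ :=
    closure_minimal (support_iteratedDeriv_subset φ k) isClosed_closure
  exact ⟨contDiff_iteratedDeriv hφ.contDiff k,
    hφ.hasCompactSupport.of_isClosed_subset isClosed_closure h, h.trans hφ.tsupport_subset⟩

protected lemma deriv (hφ : IsTestFunction φ) : IsTestFunction (deriv φ) := by
  simpa using hφ.iteratedDeriv 1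

protected lemma sub (hφ : IsTestFunction φ) (hψ : IsTestFunction ψ) :
    IsTestFunction (fun x => φ x - ψ x) := by
  have h : tsupport (fun x => φ x - ψ x) ⊆ tsupport φ ∪ tsupport ψ := tsupport_sub φ ψ
  exact ⟨hφ.contDiff.sub hψ.contDiff,
    (hφ.hasCompactSupport.union hψ.hasCompactSupport).of_isClosed_subset isClosed_closure h,
    h.trans (union_subset hφ.tsupport_subset hψ.tsupport_subset)⟩

lemma integral_unitVolume_mul (hφ : IsTestFunction φ) (g : ℝ → ℝ) :
    ∫ x, g x * φ x ∂unitVolume = ∫ x, g x * φ x := by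
  apply setIntegral_eq_integral_of_forall_compl_eq_zero
  intro x hx
  simp [hφ.eq_zero_of_notMem hx]

end IsTestFunction

lemma integral_mul_deriv_test {u φ : ℝ → ℝ} (hu : ContDiff ℝ ∞ u) (hφ : IsTestFunction φ) :
    ∫ x, u x * deriv φ x ∂unitVolume = - ∫ x, deriv u x * φ x ∂unitVolume := by
  rw [hφ.deriv.integral_unitVolume_mul, hφ.integral_unitVolume_mul]
  have hc : ∀ {f g : ℝ → ℝ}, Continuous f → IsTestFunction g → Integrable (f * g) := by
    intro f g hf hg
    exact (hf.mul hg.contDiff.continuous).integrable_of_hasCompactSupport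
      (hg.hasCompactSupport.mul_left)
  have hdu : Continuous (deriv u) := by
    simpa using continuous_iteratedDeriv_of_contDiff hu 1
  refine integral_mul_deriv_eq_deriv_mul_of_integrable
    (fun x _ => (hu.differentiable (by simp)).differentiableAt.hasDerivAt)
    (fun x _ => (hφ.contDiff.differentiable (by simp)).differentiableAt.hasDerivAt)
    (hc hu.continuous hφ.deriv) (hc hdu hφ) (hc hu.continuous hφ)

/-- The classical derivatives of a smooth function are its weak derivatives, whatever its boundary
values. -/
lemma isWeakDeriv_iteratedDeriv {u : ℝ → ℝ} (hu : ContDiff ℝ ∞ u) (k : ℕ) :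
    IsWeakDeriv k u (iteratedDeriv k u) := by
  induction k with
  | zero => intro φ _; simp
  | succ k ih =>
    intro φ hφ
    have h1 := ih (deriv φ) hφ.deriv
    rw [← iteratedDeriv_succ'] at h1
    rw [h1, integral_mul_deriv_test (contDiff_iteratedDeriv hu k) hφ, iteratedDeriv_succ, pow_succ]
    ring

/-- Weak derivatives are unique up to null sets. -/
lemma IsWeakDeriv.ae_eq {k : ℕ} {u v w : ℝ → ℝ} (hv : IsWeakDeriv k u v) (hw : IsWeakDeriv k u w)
    (hv2 : MemLp v 2 unitVolume) (hw2 : MemLp w 2 unitVolume) : v =ᵐ[unitVolume] w := by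
  have hvi : IntegrableOn v (Ioo (0 : ℝ) 1) := hv2.integrable (by norm_num)
  have hwi : IntegrableOn w (Ioo (0 : ℝ) 1) := hw2.integrable (by norm_num)
  have h := isOpen_Ioo.ae_eq_zero_of_integral_contDiff_smul_eq_zero (f := fun x => v x - w x)
    (U := Ioo (0 : ℝ) 1) (μ := volume) (hvi.sub hwi).locallyIntegrableOn ?_
  · refine (ae_restrict_iff' measurableSet_Ioo).2 (h.mono fun x hx hx' => ?_)
    exact sub_eq_zero.1 (hx hx')
  · intro g hg hgc hgs
    have hgt : IsTestFunction g := ⟨hg, hgc, hgs⟩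
    have e := (hv g hgt).symm.trans (hw g hgt)
    have e' : ∫ x, v x * g x ∂unitVolume = ∫ x, w x * g x ∂unitVolume :=
      mul_left_cancel₀ (pow_ne_zero _ (by norm_num)) e
    have hm : ∀ {f : ℝ → ℝ}, MemLp f 2 unitVolume → Integrable (fun x => f x * g x) unitVolume :=
      fun hf => hf.integrable_mul (memLp_of_continuous hg.continuous)
    calc ∫ x, g x • (v x - w x) = ∫ x, (v x - w x) * g x := by simp [mul_comm]
      _ = ∫ x, (v x - w x) * g x ∂unitVolume := (hgt.integral_unitVolume_mul _).symm
      _ = 0 := by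
        simp_rw [sub_mul]
        rw [integral_sub (hm hv2) (hm hw2), e', sub_self]

lemma weakDeriv_ae_eq {k : ℕ} {u v : ℝ → ℝ} (hv2 : MemLp v 2 unitVolume)
    (hv : IsWeakDeriv k u v) : weakDeriv k u =ᵐ[unitVolume] v := by
  have h : ∃ v : ℝ → ℝ, MemLp v 2 unitVolume ∧ IsWeakDeriv k u v := ⟨v, hv2, hv⟩
  rw [weakDeriv, dif_pos h]
  exact h.choose_spec.2.ae_eq hv h.choose_spec.1 hv2

lemma MemSobolev.weakDeriv_spec {m k : ℕ} {u : ℝ → ℝ} (hu : MemSobolev m u) (hk : k ≤ m) :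
    MemLp (weakDeriv k u) 2 unitVolume ∧ IsWeakDeriv k u (weakDeriv k u) := by
  rw [weakDeriv, dif_pos (hu.2 k hk)]
  exact (hu.2 k hk).choose_spec

lemma weakDeriv_ae_eq_iteratedDeriv {u : ℝ → ℝ} (hu : ContDiff ℝ ∞ u) (k : ℕ) :
    weakDeriv k u =ᵐ[unitVolume] iteratedDeriv k u :=
  weakDeriv_ae_eq (memLp_of_continuous (continuous_iteratedDeriv_of_contDiff hu k))
    (isWeakDeriv_iteratedDeriv hu k)

lemma integral_weakDeriv_sq {u : ℝ → ℝ} (hu : ContDiff ℝ ∞ u) (k : ℕ) :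
    ∫ x, (weakDeriv k u x) ^ 2 ∂unitVolume = ∫ x, (iteratedDeriv k u x) ^ 2 ∂unitVolume :=
  integral_congr_ae ((weakDeriv_ae_eq_iteratedDeriv hu k).mono fun x hx => by simp [hx])

lemma IsWeakDeriv.sub {k : ℕ} {u v u' v' : ℝ → ℝ} (hu : IsWeakDeriv k u u')
    (hv : IsWeakDeriv k v v') (hu2 : MemLp u 2 unitVolume) (hv2 : MemLp v 2 unitVolume)
    (hu2' : MemLp u' 2 unitVolume) (hv2' : MemLp v' 2 unitVolume) :
    IsWeakDeriv k (fun x => u x - v x) (fun x => u' x - v' x) := by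
  intro φ hφ
  have hm : ∀ {f g : ℝ → ℝ}, MemLp f 2 unitVolume → Continuous g →
      Integrable (fun x => f x * g x) unitVolume :=
    fun hf hg => hf.integrable_mul (memLp_of_continuous hg)
  have hk := hφ.continuous_iteratedDeriv k
  have h0 := hφ.contDiff.continuous
  simp_rw [sub_mul]
  rw [integral_sub (hm hu2 hk) (hm hv2 hk), integral_sub (hm hu2' h0) (hm hv2' h0), hu φ hφ,
    hv φ hφ]
  ring

lemma memSobolev_of_contDiff {u : ℝ → ℝ} (hu : ContDiff ℝ ∞ u) (m : ℕ) : MemSobolev m u :=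
  ⟨memLp_of_continuous hu.continuous, fun k _ => ⟨iteratedDeriv k u,
    memLp_of_continuous (continuous_iteratedDeriv_of_contDiff hu k),
    isWeakDeriv_iteratedDeriv hu k⟩⟩

lemma iteratedDeriv_comp_affine {u : ℝ → ℝ} (hu : ContDiff ℝ ∞ u) (k : ℕ) (s b x : ℝ) :
    iteratedDeriv k (fun y => u (s * y + b)) x = s ^ k * iteratedDeriv k u (s * x + b) := by
  have h1 : ContDiff ℝ k (fun z => u (z + b)) :=
    (hu.comp (contDiff_id.add contDiff_const)).of_le (by exact_mod_cast le_top)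
  have := congrFun (iteratedDeriv_comp_const_mul (n := k) h1 s) x
  rw [this, iteratedDeriv_comp_add_const]

/-- The derivatives of a smooth function vanishing outside `[0,1]` are bounded. -/
lemma exists_bound_iteratedDeriv {u : ℝ → ℝ} (hu : ContDiff ℝ ∞ u)
    (h0 : ∀ x, x ∉ Icc (0 : ℝ) 1 → u x = 0) (k : ℕ) :
    ∃ M, ∀ x, |iteratedDeriv k u x| ≤ M := by
  have hs : tsupport u ⊆ Icc 0 1 := closure_minimal (fun x hx => by
    by_contra h; exact hx (h0 x h)) isClosed_Icc
  have hc : HasCompactSupport (iteratedDeriv k u) :=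
    HasCompactSupport.intro isCompact_Icc fun x hx => by
      by_contra h
      exact hx (hs (support_iteratedDeriv_subset u k h))
  obtain ⟨M, hM⟩ := hc.exists_bound_of_continuous (continuous_iteratedDeriv_of_contDiff hu k)
  exact ⟨M, hM⟩

/-- A smooth function supported in the closed interval `[0,1]` is the limit in `W^{m,2}(0,1)` of its
dilations about the midpoint, which are test functions. -/
lemma memSobolevZero_of_contDiff {u : ℝ → ℝ} (hu : ContDiff ℝ ∞ u)
    (h0 : ∀ x, x ∉ Icc (0 : ℝ) 1 → u x = 0) (m : ℕ) : MemSobolevZero m u := by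
  refine ⟨memSobolev_of_contDiff hu m, ?_⟩
  let s : ℕ → ℝ := fun n => 1 + 1 / ((n : ℝ) + 1)
  have hs1 : ∀ n, 1 < s n := fun n => by
    have : (0 : ℝ) < 1 / ((n : ℝ) + 1) := by positivity
    simp only [s]; linarith
  have hs2 : ∀ n, s n ≤ 2 := fun n => by
    have : 1 / ((n : ℝ) + 1) ≤ 1 := by
      rw [div_le_one (by positivity)]
      have := Nat.cast_nonneg (α := ℝ) n
      linarith
    simp only [s]; linarith
  have hslim : Tendsto s atTop (𝓝 1) := by
    simpa [s] using (tendsto_one_div_add_atTop_nhds_zero_nat (𝕜 := ℝ)).const_add 1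
  let φ : ℕ → ℝ → ℝ := fun n x => u (s n * x + (1 - s n) / 2)
  have hφd : ∀ n, ContDiff ℝ ∞ (φ n) := fun n =>
    hu.comp ((contDiff_const.mul contDiff_id).add contDiff_const)
  have hφs : ∀ n, tsupport (φ n) ⊆ Icc (1 / 2 - 1 / (2 * s n)) (1 / 2 + 1 / (2 * s n)) := fun n => by
    refine closure_minimal (fun x hx => ?_) isClosed_Icc
    have hx' : s n * x + (1 - s n) / 2 ∈ Icc (0 : ℝ) 1 := by
      by_contra h
      exact hx (h0 _ h)
    have hp : 0 < s n := by linarith [hs1 n]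
    have e : 1 / (2 * s n) * s n = 1 / 2 := by field_simp
    constructor
    · refine le_of_mul_le_mul_right ?_ hp
      nlinarith [hx'.1]
    · refine le_of_mul_le_mul_right ?_ hp
      nlinarith [hx'.2]
  have hφt : ∀ n, IsTestFunction (φ n) := fun n => by
    refine ⟨hφd n, isCompact_Icc.of_isClosed_subset isClosed_closure (hφs n), (hφs n).trans ?_⟩
    have : 1 / (2 * s n) < 1 / 2 :=
      one_div_lt_one_div_of_lt (by norm_num) (by linarith [hs1 n])
    exact fun x hx => ⟨by linarith [hx.1], by linarith [hx.2]⟩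
  refine ⟨φ, hφt, ?_⟩
  have hterm : ∀ k, Tendsto (fun n => ∫ x, (weakDeriv k (fun x => u x - φ n x) x) ^ 2 ∂unitVolume)
      atTop (𝓝 0) := by
    intro k
    obtain ⟨M, hM⟩ := exists_bound_iteratedDeriv hu h0 k
    have hM0 : 0 ≤ M := (abs_nonneg _).trans (hM 0)
    have hc := continuous_iteratedDeriv_of_contDiff hu k
    have e : ∀ n, ∫ x, (weakDeriv k (fun x => u x - φ n x) x) ^ 2 ∂unitVolume =
        ∫ x, (iteratedDeriv k u x -
          s n ^ k * iteratedDeriv k u (s n * x + (1 - s n) / 2)) ^ 2 ∂unitVolume := by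
      intro n
      rw [integral_weakDeriv_sq (hu.sub (hφd n))]
      congr 1
      ext x
      rw [← iteratedDeriv_comp_affine hu]
      congr 1
      exact iteratedDeriv_sub (hu.contDiffAt.of_le (by exact_mod_cast le_top))
        ((hφd n).contDiffAt.of_le (by exact_mod_cast le_top))
    simp_rw [e]
    have := tendsto_integral_of_dominated_convergence (μ := unitVolume)
      (F := fun n x => (iteratedDeriv k u x -
          s n ^ k * iteratedDeriv k u (s n * x + (1 - s n) / 2)) ^ 2) (f := fun _ => 0)
      (fun _ => (M + 2 ^ k * M) ^ 2) (fun n => by fun_prop) (integrable_const _) ?_ ?_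
    · simpa using this
    · refine fun n => ae_of_all _ fun x => ?_
      rw [Real.norm_eq_abs, abs_pow]
      refine pow_le_pow_left₀ (abs_nonneg _) ((abs_sub _ _).trans (add_le_add (hM _) ?_)) 2
      rw [abs_mul, abs_of_nonneg (pow_nonneg (by linarith [hs1 n]) _)]
      exact mul_le_mul (pow_le_pow_left₀ (by linarith [hs1 n]) (hs2 n) _) (hM _) (abs_nonneg _)
        (by positivity)
    · refine ae_of_all _ fun x => ?_
      have h1 : Tendsto (fun n => s n * x + (1 - s n) / 2) atTop (𝓝 x) := by
        have := (hslim.mul_const x).add ((tendsto_const_nhds (x := (1 : ℝ)).sub hslim).div_const 2)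
        simpa using this
      have h2 := ((tendsto_const_nhds (x := iteratedDeriv k u x)).sub
        ((hslim.pow k).mul ((hc.tendsto x).comp h1))).pow 2
      simpa using h2
  have hsum := tendsto_finsetSum (Finset.range (m + 1)) fun k _ => hterm k
  simpa [sobolevNorm, Function.comp_def] using (Real.continuous_sqrt.tendsto _).comp hsum

/-! ### The bump function -/

lemma bump_eq : bump = fun x => expNegInvGlue (1 - x ^ 2) := by
  funext x
  rw [bump, expNegInvGlue]
  have : |x| < 1 ↔ ¬ (1 - x ^ 2 ≤ 0) := by
    rw [← sq_lt_one_iff_abs_lt_one]; constructor <;> intro h <;> linarith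
  simp only [this, ite_not, neg_div, one_div]

lemma contDiff_bump : ContDiff ℝ ∞ bump := by
  rw [bump_eq]
  exact expNegInvGlue.contDiff.comp (contDiff_const.sub (contDiff_id.pow 2))

lemma bump_nonneg (x : ℝ) : 0 ≤ bump x := by
  rw [bump_eq]; exact expNegInvGlue.nonneg _

lemma bump_eq_zero {x : ℝ} (hx : 1 ≤ |x|) : bump x = 0 := by
  rw [bump, if_neg (not_lt.2 hx)]

lemma bump_le_bump_zero (x : ℝ) : bump x ≤ bump 0 := by
  rw [bump_eq]; exact expNegInvGlue.monotone (by nlinarith [sq_nonneg x])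

lemma bumpMax_eq : bumpMax = bump 0 :=
  le_antisymm (ciSup_le bump_le_bump_zero)
    (le_ciSup ⟨bump 0, by rintro _ ⟨x, rfl⟩; exact bump_le_bump_zero x⟩ 0)

lemma bumpMax_pos : 0 < bumpMax := by
  rw [bumpMax_eq, bump, if_pos (by simp)]; exact Real.exp_pos _

lemma bump_le (x : ℝ) : bump x ≤ bumpMax := bumpMax_eq ▸ bump_le_bump_zero x

lemma tsupport_bump_subset : tsupport bump ⊆ Icc (-1) 1 :=
  closure_minimal (fun x hx => by
    by_contra h
    refine hx (bump_eq_zero ?_)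
    by_contra h'
    exact h ⟨(abs_lt.1 (not_le.1 h')).1.le, (abs_lt.1 (not_le.1 h')).2.le⟩) isClosed_Icc

lemma iteratedDeriv_bump_eq_zero {x : ℝ} (hx : 1 < |x|) (k : ℕ) : iteratedDeriv k bump x = 0 := by
  by_contra h
  have := tsupport_bump_subset (support_iteratedDeriv_subset bump k h)
  exact absurd (abs_le.2 this) (not_le.2 hx)

lemma continuous_iteratedDeriv_bump (k : ℕ) : Continuous (iteratedDeriv k bump) :=
  continuous_iteratedDeriv_of_contDiff contDiff_bump k

/-- No derivative of the bump vanishes identically: a compactly supported function with zero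
derivative is zero. -/
lemma iteratedDeriv_bump_ne_zero (k : ℕ) : iteratedDeriv k bump ≠ 0 := by
  induction k with
  | zero =>
    intro h
    have := congrFun h 0
    rw [iteratedDeriv_zero, ← bumpMax_eq] at this
    exact bumpMax_pos.ne' this
  | succ k ih =>
    intro h
    apply ih
    rw [iteratedDeriv_succ] at h
    funext x
    have hd : Differentiable ℝ (iteratedDeriv k bump) :=
      (contDiff_iteratedDeriv contDiff_bump k).differentiable (by simp)
    rw [is_const_of_deriv_eq_zero hd (fun x => congrFun h x) x 2]
    exact iteratedDeriv_bump_eq_zero (by norm_num) k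

lemma bumpEnergy_pos (k : ℕ) : 0 < bumpEnergy k := by
  have hc := continuous_iteratedDeriv_bump k
  obtain ⟨x, hx⟩ := Function.ne_iff.1 (iteratedDeriv_bump_ne_zero k)
  have hx1 : x ∈ Icc (-1 : ℝ) 1 := by
    by_contra h
    exact hx (iteratedDeriv_bump_eq_zero (by
      by_contra h'
      exact h (abs_le.1 (not_lt.1 h'))) k)
  refine intervalIntegral.integral_pos (by norm_num) (hc.pow 2).continuousOn
    (fun _ _ => sq_nonneg _) ⟨x, hx1, ?_⟩
  exact (sq_pos_iff (a := iteratedDeriv k bump x)).2 hx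

lemma constC_pos (m : ℕ) : 0 < constC m :=
  Real.rpow_pos_of_pos (div_pos bumpMax_pos (mul_pos (Real.rpow_pos_of_pos (by norm_num) _)
    (Real.sqrt_pos.2 (bumpEnergy_pos m)))) _

lemma constC'_pos (m₁ m₂ : ℕ) : 0 < constC' m₁ m₂ :=
  mul_pos (mul_pos (Real.rpow_pos_of_pos (by norm_num) _)
    (Real.rpow_pos_of_pos (div_pos (constC_pos _) (by norm_num)) _))
    (div_pos (Real.sqrt_pos.2 (bumpEnergy_pos _)) bumpMax_pos)

/-- The translate to the centre `c`, and dilate to the half-width `h`, of the bump function,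
normalized to have height `a`. -/
noncomputable def scaledBump (a c h x : ℝ) : ℝ := a / bumpMax * bump ((x - c) / h)

lemma contDiff_scaledBump (a c h : ℝ) : ContDiff ℝ ∞ (scaledBump a c h) :=
  contDiff_const.mul (contDiff_bump.comp ((contDiff_id.sub contDiff_const).div_const h))

lemma scaledBump_center (a c h : ℝ) : scaledBump a c h c = a := by
  rw [scaledBump, sub_self, zero_div, ← bumpMax_eq, div_mul_cancel₀ _ bumpMax_pos.ne']

lemma scaledBump_nonneg {a : ℝ} (ha : 0 ≤ a) (c h x : ℝ) : 0 ≤ scaledBump a c h x :=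
  mul_nonneg (div_nonneg ha bumpMax_pos.le) (bump_nonneg _)

lemma scaledBump_le {a : ℝ} (ha : 0 ≤ a) (c h x : ℝ) : scaledBump a c h x ≤ a := by
  calc a / bumpMax * bump ((x - c) / h) ≤ a / bumpMax * bumpMax :=
        mul_le_mul_of_nonneg_left (bump_le _) (div_nonneg ha bumpMax_pos.le)
    _ = a := div_mul_cancel₀ _ bumpMax_pos.ne'

lemma one_le_abs_div {h x : ℝ} (hh : 0 < h) : 1 ≤ |x / h| ↔ h ≤ |x| := by
  rw [abs_div, abs_of_pos hh, one_le_div hh]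

lemma scaledBump_eq_zero {a c h x : ℝ} (hh : 0 < h) (hx : h ≤ |x - c|) : scaledBump a c h x = 0 := by
  rw [scaledBump, bump_eq_zero ((one_le_abs_div hh).2 hx), mul_zero]

lemma iteratedDeriv_scaledBump (a c h : ℝ) (k : ℕ) (x : ℝ) :
    iteratedDeriv k (scaledBump a c h) x =
      a / bumpMax * (h⁻¹ ^ k * iteratedDeriv k bump ((x - c) / h)) := by
  have e : scaledBump a c h = fun y => a / bumpMax * (fun y => bump (h⁻¹ * y + -(h⁻¹ * c))) y := by
    funext y; rw [scaledBump]; congr 2; ring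
  rw [e, iteratedDeriv_const_mul_field, iteratedDeriv_comp_affine contDiff_bump]
  congr 4; ring

lemma iteratedDeriv_scaledBump_eq_zero {a c h x : ℝ} (hh : 0 < h) (hx : h < |x - c|) (k : ℕ) :
    iteratedDeriv k (scaledBump a c h) x = 0 := by
  rw [iteratedDeriv_scaledBump, iteratedDeriv_bump_eq_zero, mul_zero, mul_zero]
  rwa [abs_div, abs_of_pos hh, one_lt_div hh]

lemma integral_iteratedDeriv_scaledBump_sq {a c h : ℝ} (hh : 0 < h) (h0 : 0 ≤ c - h)
    (h1 : c + h ≤ 1) (k : ℕ) :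
    ∫ x, (iteratedDeriv k (scaledBump a c h) x) ^ 2 ∂unitVolume =
      (a / bumpMax) ^ 2 * (h⁻¹ ^ k) ^ 2 * h * bumpEnergy k := by
  rw [integral_unitVolume_eq_intervalIntegral]
  have hc : Continuous fun x => (iteratedDeriv k (scaledBump a c h) x) ^ 2 :=
    (continuous_iteratedDeriv_of_contDiff (contDiff_scaledBump a c h) k).pow 2
  have hi : ∀ p q : ℝ, IntervalIntegrable
      (fun x => (iteratedDeriv k (scaledBump a c h) x) ^ 2) volume p q :=
    fun p q => hc.intervalIntegrable p q
  have z1 : ∫ x in (0 : ℝ)..(c - h), (iteratedDeriv k (scaledBump a c h) x) ^ 2 = 0 := by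
    rw [intervalIntegral.integral_of_le h0, integral_Ioc_eq_integral_Ioo]
    refine setIntegral_eq_zero_of_forall_eq_zero fun x hx => ?_
    rw [iteratedDeriv_scaledBump_eq_zero hh (by
      rw [abs_of_nonpos] <;> linarith [hx.2]), zero_pow two_ne_zero]
  have z2 : ∫ x in (c + h)..(1 : ℝ), (iteratedDeriv k (scaledBump a c h) x) ^ 2 = 0 := by
    rw [intervalIntegral.integral_of_le h1]
    refine setIntegral_eq_zero_of_forall_eq_zero fun x hx => ?_
    rw [iteratedDeriv_scaledBump_eq_zero hh (by
      rw [abs_of_nonneg] <;> linarith [hx.1]), zero_pow two_ne_zero]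
  rw [← intervalIntegral.integral_add_adjacent_intervals (hi 0 (c - h)) (hi (c - h) 1),
    ← intervalIntegral.integral_add_adjacent_intervals (hi (c - h) (c + h)) (hi (c + h) 1), z1, z2,
    zero_add, add_zero]
  have e : (fun x => (iteratedDeriv k (scaledBump a c h) x) ^ 2) = fun x =>
      (fun z => (a / bumpMax) ^ 2 * (h⁻¹ ^ k) ^ 2 * (iteratedDeriv k bump z) ^ 2)
        (x / h - c / h) := by
    funext x
    rw [iteratedDeriv_scaledBump, sub_div]
    ring
  rw [e, intervalIntegral.integral_comp_div_sub (fun z => (a / bumpMax) ^ 2 * (h⁻¹ ^ k) ^ 2 *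
    (iteratedDeriv k bump z) ^ 2) hh.ne', intervalIntegral.integral_const_mul,
    bumpEnergy, smul_eq_mul]
  have e1 : (c - h) / h - c / h = -1 := by field_simp; ring
  have e2 : (c + h) / h - c / h = 1 := by field_simp; ring
  rw [e1, e2]
  ring

/-! ### Membership in a reproducing kernel Hilbert space -/

section RKHS

variable {H X : Type*} [NormedAddCommGroup H] [InnerProductSpace ℝ H] [CompleteSpace H]
  [RKHS ℝ H X ℝ]

/-- A function belongs to the space, with norm at most `C`, as soon as the functional it induces on
combinations of kernel functions is bounded by `C`: extend that functional by Hahn–Banach and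
represent it by Riesz. -/
lemma exists_mem_rkhs_of_bound (u : X → ℝ) {C : ℝ} (hC : 0 ≤ C)
    (h : ∀ a : X →₀ ℝ, |Finsupp.linearCombination ℝ u a| ≤
      C * ‖Finsupp.linearCombination ℝ (fun x => RKHS.kerFun H x (1 : ℝ)) a‖) :
    ∃ g : H, (∀ x, g x = u x) ∧ ‖g‖ ≤ C := by
  set S := Finsupp.linearCombination ℝ (fun x => RKHS.kerFun H x (1 : ℝ)) with hS
  set l := Finsupp.linearCombination ℝ u with hl
  obtain ⟨s, hs⟩ := S.rangeRestrict.exists_rightInverse_of_surjective S.range_rangeRestrict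
  have hs' : ∀ v, S (s v) = v := fun v => congrArg Subtype.val (LinearMap.congr_fun hs v)
  let F : StrongDual ℝ (LinearMap.range S) := (l.comp s).mkContinuous C fun v => by
    have := h (s v)
    rwa [hs'] at this
  obtain ⟨G, hG, hGn⟩ := exists_extension_norm_eq (LinearMap.range S) F
  refine ⟨(InnerProductSpace.toDual ℝ H).symm G, fun x => ?_, ?_⟩
  · have e1 : S (Finsupp.single x 1) = RKHS.kerFun H x (1 : ℝ) := by simp [hS]
    have e2 : l (Finsupp.single x 1) = u x := by simp [hl]
    have e3 : l (s (S.rangeRestrict (Finsupp.single x 1))) = l (Finsupp.single x 1) := by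
      have := h (s (S.rangeRestrict (Finsupp.single x 1)) - Finsupp.single x 1)
      rw [map_sub, map_sub, hs', LinearMap.codRestrict_apply, sub_self, norm_zero, mul_zero] at this
      exact sub_eq_zero.1 (abs_nonpos_iff.1 this)
    have e4 := RKHS.inner_kerFun x (1 : ℝ) ((InnerProductSpace.toDual ℝ H).symm G)
    rw [InnerProductSpace.toDual_symm_apply, ← e1] at e4
    have e5 := hG (S.rangeRestrict (Finsupp.single x 1))
    rw [LinearMap.codRestrict_apply, e4] at e5
    rw [← e2, ← e3]
    refine Eq.trans ?_ e5
    simp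
  · rw [LinearIsometryEquiv.norm_map, hGn]
    exact LinearMap.mkContinuous_norm_le _ hC _

lemma norm_linearCombination_kerFun_sq (a : X →₀ ℝ) :
    ‖Finsupp.linearCombination ℝ (fun x => RKHS.kerFun H x (1 : ℝ)) a‖ ^ 2 =
      ∑ x ∈ a.support, ∑ y ∈ a.support, a x * a y * RKHS.kernel H x y 1 := by
  rw [← real_inner_self_eq_norm_sq, Finsupp.linearCombination_apply, Finsupp.sum, sum_inner]
  refine Finset.sum_congr rfl fun x _ => ?_
  rw [inner_sum]
  refine Finset.sum_congr rfl fun y _ => ?_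
  rw [real_inner_smul_left, real_inner_smul_right, RKHS.kerFun_inner, RKHS.kerFun_apply]
  simp [mul_assoc]

end RKHS

/-! ### Fourier estimates -/

/-- The exponential sum `∑ a_x e^{2π i x w}`. -/
noncomputable def expSum (a : unitInterval →₀ ℝ) (w : ℝ) : ℂ :=
  ∑ x ∈ a.support, (a x : ℂ) * Complex.exp ((2 * Real.pi * (w * x) : ℝ) * Complex.I)

lemma continuous_expSum (a : unitInterval →₀ ℝ) : Continuous (expSum a) := by
  unfold expSum; fun_prop

lemma norm_expSum_le (a : unitInterval →₀ ℝ) (w : ℝ) : ‖expSum a w‖ ≤ ∑ x ∈ a.support, |a x| := by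
  refine (norm_sum_le _ _).trans (Finset.sum_le_sum fun x _ => ?_)
  rw [norm_mul, Complex.norm_exp_ofReal_mul_I, mul_one, Complex.norm_real, Real.norm_eq_abs]

lemma norm_expSum_sq (a : unitInterval →₀ ℝ) (w : ℝ) : ((‖expSum a w‖ ^ 2 : ℝ) : ℂ) =
    ∑ x ∈ a.support, ∑ y ∈ a.support, (a x * a y : ℂ) *
      Complex.exp ((2 * Real.pi * (w * (x - y)) : ℝ) * Complex.I) := by
  rw [← Complex.normSq_eq_norm_sq, ← Complex.mul_conj, expSum, map_sum, Finset.sum_mul_sum]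
  refine Finset.sum_congr rfl fun x _ => Finset.sum_congr rfl fun y _ => ?_
  rw [map_mul, ← Complex.exp_conj, map_mul, Complex.conj_I, Complex.conj_ofReal,
    Complex.conj_ofReal, mul_mul_mul_comm, ← Complex.exp_add]
  congr 2
  push_cast
  ring

lemma integrable_inv_one_add_sq_pow {m : ℕ} (hm : 0 < m) :
    Integrable fun w : ℝ => ((1 + w ^ 2) ^ m)⁻¹ := by
  refine integrable_inv_one_add_sq.mono' ?_ (ae_of_all _ fun w => ?_)
  · exact (Continuous.inv₀ (by fun_prop) fun w => by positivity).aestronglyMeasurable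
  · rw [Real.norm_of_nonneg (by positivity)]
    exact inv_anti₀ (by positivity) (le_self_pow₀ (by nlinarith [sq_nonneg w]) hm.ne')

namespace HasFourierDecay

variable {κ : ℝ → ℝ} {m : ℕ}

/-- Evenness of the kernel makes its Fourier transform real. -/
lemma fourier_im (hκ : HasFourierDecay κ m) (w : ℝ) : (𝓕 (fun x : ℝ => (κ x : ℂ)) w).im = 0 := by
  rw [← Complex.conj_eq_iff_im, Real.fourier_real_eq_integral_exp_smul, ← integral_conj,
    ← integral_neg_eq_self]
  congr 1
  funext x
  simp only [smul_eq_mul, map_mul, ← Complex.exp_conj, Complex.conj_ofReal, Complex.conj_I,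
    hκ.even]
  congr 2
  push_cast
  ring

lemma integrable_fourier (hκ : HasFourierDecay κ m) (hm : 0 < m) :
    Integrable (𝓕 (fun x : ℝ => (κ x : ℂ))) := by
  obtain ⟨c₁, c₂, hc₁, hc, h⟩ := hκ.decay
  refine ((integrable_inv_one_add_sq_pow hm).const_mul c₂).mono' ?_ (ae_of_all _ fun w => ?_)
  · exact (VectorFourier.fourierIntegral_continuous Real.continuous_fourierChar
      (by exact continuous_inner) hκ.integrable.ofReal).aestronglyMeasurable
  · have e : 𝓕 (fun x : ℝ => (κ x : ℂ)) w = (((𝓕 (fun x : ℝ => (κ x : ℂ)) w).re : ℝ) : ℂ) :=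
      Complex.ext rfl (by simpa using hκ.fourier_im w)
    rw [e, Complex.norm_real, Real.norm_of_nonneg]
    · exact (h w).2
    · exact le_trans (by positivity) (h w).1

lemma eq_integral (hκ : HasFourierDecay κ m) (hm : 0 < m) (x : ℝ) :
    (κ x : ℂ) = ∫ w, Complex.exp ((2 * Real.pi * (w * x) : ℝ) * Complex.I) *
      𝓕 (fun x : ℝ => (κ x : ℂ)) w := by
  have h := congrFun (Continuous.fourierInv_fourier_eq (f := fun x : ℝ => (κ x : ℂ))
    (Complex.continuous_ofReal.comp hκ.continuous) hκ.integrable.ofReal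
    (hκ.integrable_fourier hm)) x
  rw [Real.fourierInv_eq'] at h
  rw [← h]
  simp [mul_comm]

lemma integrable_expSum_sq (hκ : HasFourierDecay κ m) (hm : 0 < m) (a : unitInterval →₀ ℝ) :
    Integrable fun w => ((‖expSum a w‖ ^ 2 : ℝ) : ℂ) * 𝓕 (fun x : ℝ => (κ x : ℂ)) w := by
  refine (hκ.integrable_fourier hm).bdd_mul (c := (∑ x ∈ a.support, |a x|) ^ 2) ?_ ?_
  · have := continuous_expSum a
    exact (by fun_prop : Continuous fun w => ((‖expSum a w‖ ^ 2 : ℝ) : ℂ)).aestronglyMeasurable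
  · refine ae_of_all _ fun w => ?_
    rw [Complex.norm_real, Real.norm_of_nonneg (by positivity)]
    exact pow_le_pow_left₀ (norm_nonneg _) (norm_expSum_le a w) 2

/-- Bochner's formula for the quadratic form of the kernel. -/
lemma quadratic_form_eq (hκ : HasFourierDecay κ m) (hm : 0 < m) (a : unitInterval →₀ ℝ) :
    ∑ x ∈ a.support, ∑ y ∈ a.support, a x * a y * κ ((x : ℝ) - y) =
      ∫ w, ‖expSum a w‖ ^ 2 * (𝓕 (fun x : ℝ => (κ x : ℂ)) w).re := by
  have h : ((∑ x ∈ a.support, ∑ y ∈ a.support, a x * a y * κ ((x : ℝ) - y) : ℝ) : ℂ) =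
      ∫ w, ((‖expSum a w‖ ^ 2 : ℝ) : ℂ) * 𝓕 (fun x : ℝ => (κ x : ℂ)) w := by
    have hi : ∀ x y : unitInterval, Integrable fun w : ℝ => (a x * a y : ℂ) *
        (Complex.exp ((2 * Real.pi * (w * (x - y)) : ℝ) * Complex.I) *
          𝓕 (fun x : ℝ => (κ x : ℂ)) w) := fun x y => by
      refine Integrable.const_mul ((hκ.integrable_fourier hm).bdd_mul (c := 1) ?_ ?_) _
      · exact Continuous.aestronglyMeasurable (by fun_prop)
      · exact ae_of_all _ fun w => (Complex.norm_exp_ofReal_mul_I _).le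
    simp_rw [norm_expSum_sq, Finset.sum_mul, mul_assoc (_ * _ : ℂ)]
    rw [integral_finsetSum _ fun x _ => integrable_finsetSum _ fun y _ => hi x y]
    simp_rw [integral_finsetSum _ fun y _ => hi _ y, integral_const_mul]
    push_cast
    refine Finset.sum_congr rfl fun x _ => Finset.sum_congr rfl fun y _ => ?_
    rw [hκ.eq_integral hm]
    push_cast
    rfl
  rw [← Complex.ofReal_re (∑ x ∈ a.support, ∑ y ∈ a.support, a x * a y * κ ((x : ℝ) - y)), h,
    ← RCLike.re_eq_complex_re, ← integral_re (hκ.integrable_expSum_sq hm a)]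
  congr 1
  funext w
  rw [RCLike.re_eq_complex_re, Complex.re_ofReal_mul]

end HasFourierDecay

namespace IsTestFunction

variable {φ : ℝ → ℝ}

/-- A test function as a complex-valued Schwartz function. -/
noncomputable def toSchwartz (hφ : IsTestFunction φ) : SchwartzMap ℝ ℂ :=
  HasCompactSupport.toSchwartzMap (f := fun x => (φ x : ℂ)) (hφ.hasCompactSupport.comp_left (g := Complex.ofReal) Complex.ofReal_zero)
    (Complex.ofRealCLM.contDiff.comp hφ.contDiff)

@[simp] lemma coe_toSchwartz (hφ : IsTestFunction φ) : ⇑hφ.toSchwartz = fun x => (φ x : ℂ) := rfl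

lemma fourier_deriv (hφ : IsTestFunction φ) (w : ℝ) :
    𝓕 (fun x => ((deriv φ x : ℝ) : ℂ)) w = 2 * Real.pi * Complex.I * w * 𝓕 (fun x => (φ x : ℂ)) w := by
  have hd : ∀ x, HasDerivAt (fun x => (φ x : ℂ)) ((deriv φ x : ℝ) : ℂ) x := fun x =>
    ((hφ.contDiff.differentiable (by simp)).differentiableAt.hasDerivAt).ofReal_comp
  have e : deriv (fun x => (φ x : ℂ)) = fun x => ((deriv φ x : ℝ) : ℂ) := funext fun x => (hd x).deriv
  have := congrFun (Real.fourier_deriv (f := fun x => (φ x : ℂ)) hφ.toSchwartz.integrable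
    (fun x => (hd x).differentiableAt) (by rw [e]; exact hφ.deriv.toSchwartz.integrable)) w
  rw [e] at this
  simpa using this

lemma fourier_iteratedDeriv (hφ : IsTestFunction φ) (k : ℕ) (w : ℝ) :
    𝓕 (fun x => ((iteratedDeriv k φ x : ℝ) : ℂ)) w =
      (2 * Real.pi * Complex.I * w) ^ k * 𝓕 (fun x => (φ x : ℂ)) w := by
  induction k with
  | zero => simp
  | succ k ih =>
    rw [iteratedDeriv_succ, (hφ.iteratedDeriv k).fourier_deriv, ih, pow_succ]
    ring

lemma integral_sq_fourier (hφ : IsTestFunction φ) :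
    ∫ w, ‖𝓕 (fun x => (φ x : ℂ)) w‖ ^ 2 = ∫ x, φ x ^ 2 ∂unitVolume := by
  have h := SchwartzMap.integral_norm_sq_fourier hφ.toSchwartz
  rw [SchwartzMap.fourier_coe] at h
  simp only [coe_toSchwartz, Complex.norm_real, Real.norm_eq_abs, sq_abs] at h
  rw [h]
  simp_rw [pow_two]
  exact (hφ.integral_unitVolume_mul _).symm

lemma integrable_sq_fourier (hφ : IsTestFunction φ) :
    Integrable fun w => ‖𝓕 (fun x => (φ x : ℂ)) w‖ ^ 2 := by
  have h := ((𝓕 hφ.toSchwartz).memLp 2 volume).integrable_norm_pow (by norm_num)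
  simpa [SchwartzMap.fourier_coe] using h

lemma eq_integral (hφ : IsTestFunction φ) (x : ℝ) :
    (φ x : ℂ) = ∫ w, Complex.exp ((2 * Real.pi * (w * x) : ℝ) * Complex.I) *
      𝓕 (fun x : ℝ => (φ x : ℂ)) w := by
  have h := congrFun (Continuous.fourierInv_fourier_eq (f := fun x : ℝ => (φ x : ℂ))
    hφ.toSchwartz.continuous hφ.toSchwartz.integrable (𝓕 hφ.toSchwartz).integrable) x
  rw [Real.fourierInv_eq'] at h
  rw [← h]
  simp [mul_comm]

lemma linearCombination_eq_integral (hφ : IsTestFunction φ) (a : unitInterval →₀ ℝ) :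
    ((Finsupp.linearCombination ℝ (fun x : unitInterval => φ x) a : ℝ) : ℂ) =
      ∫ w, expSum a w * 𝓕 (fun x : ℝ => (φ x : ℂ)) w := by
  have hi : ∀ x : unitInterval, Integrable fun w : ℝ => (a x : ℂ) *
      (Complex.exp ((2 * Real.pi * (w * x) : ℝ) * Complex.I) *
        𝓕 (fun x : ℝ => (φ x : ℂ)) w) := fun x => by
    refine Integrable.const_mul (Integrable.bdd_mul (c := 1)
      (𝓕 hφ.toSchwartz).integrable ?_ ?_) _
    · exact Continuous.aestronglyMeasurable (by fun_prop)
    · exact ae_of_all _ fun w => (Complex.norm_exp_ofReal_mul_I _).le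
  simp_rw [expSum, Finset.sum_mul, mul_assoc (_ : ℂ) (Complex.exp _)]
  rw [integral_finsetSum _ fun x _ => hi x]
  simp_rw [integral_const_mul, ← hφ.eq_integral]
  simp [Finsupp.linearCombination_apply, Finsupp.sum]

/-- The weighted `L²` norm of the Fourier transform is controlled by the function and its `m`-th
derivative, since `(1 + w²)^m ≤ 2^m (1 + w^{2m})`. -/
lemma integral_weighted_fourier (hφ : IsTestFunction φ) (m : ℕ) :
    (Integrable fun w : ℝ => ‖𝓕 (fun x => (φ x : ℂ)) w‖ ^ 2 * (1 + w ^ 2) ^ m) ∧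
    ∫ w : ℝ, ‖𝓕 (fun x => (φ x : ℂ)) w‖ ^ 2 * (1 + w ^ 2) ^ m ≤
      2 ^ m * (∫ x, φ x ^ 2 ∂unitVolume + ∫ x, iteratedDeriv m φ x ^ 2 ∂unitVolume) := by
  have hi1 := hφ.integrable_sq_fourier
  have hi2 := (hφ.iteratedDeriv m).integrable_sq_fourier
  have hi := (hi1.add hi2).const_mul (2 ^ m)
  have hle : ∀ w : ℝ, ‖𝓕 (fun x => (φ x : ℂ)) w‖ ^ 2 * (1 + w ^ 2) ^ m ≤
      2 ^ m * (‖𝓕 (fun x => (φ x : ℂ)) w‖ ^ 2 +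
        ‖𝓕 (fun x => ((iteratedDeriv m φ x : ℝ) : ℂ)) w‖ ^ 2) := by
    intro w
    rw [hφ.fourier_iteratedDeriv]
    have e : ‖(2 * (Real.pi : ℂ) * Complex.I * w) ^ m * 𝓕 (fun x => (φ x : ℂ)) w‖ ^ 2 =
        ((4 * Real.pi ^ 2) * w ^ 2) ^ m * ‖𝓕 (fun x => (φ x : ℂ)) w‖ ^ 2 := by
      rw [norm_mul, norm_pow, mul_pow, ← pow_mul, mul_comm m 2, pow_mul]
      congr 2
      simp only [norm_mul, Complex.norm_real, Complex.norm_I, Complex.norm_ofNat, mul_pow,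
        Real.norm_eq_abs, sq_abs]
      ring
    rw [e]
    have h1 : (w ^ 2) ^ m ≤ ((4 * Real.pi ^ 2) * w ^ 2) ^ m := by
      refine pow_le_pow_left₀ (sq_nonneg w) ?_ m
      exact le_mul_of_one_le_left (sq_nonneg w) (by nlinarith [Real.pi_gt_three])
    have h2 : (1 + w ^ 2) ^ m ≤ 2 ^ m * (1 + (w ^ 2) ^ m) := by
      rcases le_total (w ^ 2) 1 with h | h
      · calc (1 + w ^ 2) ^ m ≤ 2 ^ m := pow_le_pow_left₀ (by positivity) (by linarith) m
          _ ≤ _ := le_mul_of_one_le_right (by positivity) (by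
            have : 0 ≤ (w ^ 2) ^ m := by positivity
            linarith)
      · calc (1 + w ^ 2) ^ m ≤ (2 * w ^ 2) ^ m :=
              pow_le_pow_left₀ (by positivity) (by linarith) m
          _ = 2 ^ m * (w ^ 2) ^ m := mul_pow _ _ _
          _ ≤ _ := mul_le_mul_of_nonneg_left (by linarith) (by positivity)
    calc ‖𝓕 (fun x => (φ x : ℂ)) w‖ ^ 2 * (1 + w ^ 2) ^ m
        ≤ ‖𝓕 (fun x => (φ x : ℂ)) w‖ ^ 2 * (2 ^ m * (1 + ((4 * Real.pi ^ 2) * w ^ 2) ^ m)) := by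
          refine mul_le_mul_of_nonneg_left (h2.trans ?_) (by positivity)
          exact mul_le_mul_of_nonneg_left (by linarith) (by positivity)
      _ = _ := by ring
  have hint : Integrable fun w : ℝ => ‖𝓕 (fun x => (φ x : ℂ)) w‖ ^ 2 * (1 + w ^ 2) ^ m := by
    refine hi.mono' ?_ (ae_of_all _ fun w => ?_)
    · exact hi1.aestronglyMeasurable.mul (Continuous.aestronglyMeasurable (by fun_prop))
    · rw [Real.norm_of_nonneg (by positivity)]
      exact hle w
  refine ⟨hint, (integral_mono hint hi hle).trans_eq ?_⟩
  rw [integral_const_mul]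
  simp only [Pi.add_apply]
  rw [integral_add hi1 hi2, hφ.integral_sq_fourier, (hφ.iteratedDeriv m).integral_sq_fourier]

end IsTestFunction

/-- The Cauchy–Schwarz inequality for integrals of nonnegative functions. -/
lemma sq_integral_mul_le {μ : Measure ℝ} {f g : ℝ → ℝ} (hf : MemLp f 2 μ) (hg : MemLp g 2 μ)
    (hf0 : ∀ x, 0 ≤ f x) (hg0 : ∀ x, 0 ≤ g x) :
    (∫ x, f x * g x ∂μ) ^ 2 ≤ (∫ x, f x ^ 2 ∂μ) * ∫ x, g x ^ 2 ∂μ := by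
  have h := integral_mul_le_Lp_mul_Lq_of_nonneg (μ := μ) (p := 2) (q := 2)
    ⟨by norm_num, by norm_num, by norm_num⟩
    (ae_of_all _ hf0) (ae_of_all _ hg0) (by simpa using hf) (by simpa using hg)
  simp only [Real.rpow_two, ← Real.sqrt_eq_rpow] at h
  have h0 : 0 ≤ ∫ x, f x * g x ∂μ := integral_nonneg fun x => mul_nonneg (hf0 x) (hg0 x)
  calc (∫ x, f x * g x ∂μ) ^ 2 ≤ (√(∫ x, f x ^ 2 ∂μ) * √(∫ x, g x ^ 2 ∂μ)) ^ 2 :=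
        pow_le_pow_left₀ h0 h 2
    _ = _ := by
      rw [mul_pow, Real.sq_sqrt (integral_nonneg fun x => sq_nonneg _),
        Real.sq_sqrt (integral_nonneg fun x => sq_nonneg _)]

/-- Point evaluations of a test function are bounded by the kernel norm, by Cauchy–Schwarz on the
Fourier side. -/
lemma sq_linearCombination_le {κ φ : ℝ → ℝ} {m : ℕ} (hm : 0 < m) (hκ : HasFourierDecay κ m)
    {c₁ : ℝ} (hc₁ : 0 < c₁)
    (hlow : ∀ w : ℝ, c₁ * ((1 + w ^ 2) ^ m)⁻¹ ≤ (𝓕 (fun x : ℝ => (κ x : ℂ)) w).re)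
    (hφ : IsTestFunction φ) (a : unitInterval →₀ ℝ) :
    (Finsupp.linearCombination ℝ (fun x : unitInterval => φ x) a) ^ 2 ≤
      2 ^ m * (∫ x, φ x ^ 2 ∂unitVolume + ∫ x, iteratedDeriv m φ x ^ 2 ∂unitVolume) *
        (c₁⁻¹ * ∑ x ∈ a.support, ∑ y ∈ a.support, a x * a y * κ ((x : ℝ) - y)) := by
  obtain ⟨hint, hle⟩ := hφ.integral_weighted_fourier m
  have hc := continuous_expSum a
  have hF : Continuous (𝓕 (fun x => (φ x : ℂ))) := (𝓕 hφ.toSchwartz).continuous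
  have hintA : Integrable fun w => ‖expSum a w‖ ^ 2 * (𝓕 (fun x : ℝ => (κ x : ℂ)) w).re := by
    have := (hκ.integrable_expSum_sq hm a).re
    simpa only [RCLike.re_eq_complex_re, Complex.re_ofReal_mul] using this
  have hintB : Integrable fun w : ℝ => ‖expSum a w‖ ^ 2 * ((1 + w ^ 2) ^ m)⁻¹ := by
    refine (hintA.const_mul c₁⁻¹).mono' ?_ (ae_of_all _ fun w => ?_)
    · exact Continuous.aestronglyMeasurable ((hc.norm.pow 2).mul
        (Continuous.inv₀ (by fun_prop) fun w => by positivity))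
    · rw [Real.norm_of_nonneg (by positivity), mul_left_comm]
      refine mul_le_mul_of_nonneg_left ?_ (by positivity)
      rw [inv_mul_eq_div, le_div_iff₀ hc₁, mul_comm]
      exact hlow w
  have hB : ∫ w : ℝ, ‖expSum a w‖ ^ 2 * ((1 + w ^ 2) ^ m)⁻¹ ≤
      c₁⁻¹ * ∑ x ∈ a.support, ∑ y ∈ a.support, a x * a y * κ ((x : ℝ) - y) := by
    rw [hκ.quadratic_form_eq hm a, ← integral_const_mul]
    refine integral_mono hintB (hintA.const_mul _) fun w => ?_
    simp only
    rw [mul_left_comm]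
    refine mul_le_mul_of_nonneg_left ?_ (by positivity)
    rw [inv_mul_eq_div, le_div_iff₀ hc₁, mul_comm]
    exact hlow w
  have hsq : ∀ w : ℝ, 0 < √((1 + w ^ 2) ^ m) := fun w => Real.sqrt_pos.2 (by positivity)
  have hsq2 : ∀ w : ℝ, √((1 + w ^ 2) ^ m) ^ 2 = (1 + w ^ 2) ^ m := fun w =>
    Real.sq_sqrt (by positivity)
  have hw : Continuous fun w : ℝ => √((1 + w ^ 2) ^ m) := by fun_prop
  have hfm : MemLp (fun w : ℝ => ‖𝓕 (fun x => (φ x : ℂ)) w‖ * √((1 + w ^ 2) ^ m)) 2 := by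
    refine (memLp_two_iff_integrable_sq (hF.norm.mul hw).aestronglyMeasurable).2 ?_
    simpa only [Pi.mul_apply, mul_pow, hsq2] using hint
  have hgm : MemLp (fun w : ℝ => ‖expSum a w‖ * (√((1 + w ^ 2) ^ m))⁻¹) 2 := by
    refine (memLp_two_iff_integrable_sq
      (hc.norm.mul (hw.inv₀ fun w => (hsq w).ne')).aestronglyMeasurable).2 ?_
    simpa only [Pi.mul_apply, Pi.inv_apply, mul_pow, inv_pow, hsq2] using hintB
  have hcs := sq_integral_mul_le hfm hgm (fun w => by positivity) (fun w => by positivity)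
  simp only [mul_pow, inv_pow, hsq2] at hcs
  have habs : |Finsupp.linearCombination ℝ (fun x : unitInterval => φ x) a| ≤
      ∫ w : ℝ, ‖𝓕 (fun x => (φ x : ℂ)) w‖ * √((1 + w ^ 2) ^ m) *
        (‖expSum a w‖ * (√((1 + w ^ 2) ^ m))⁻¹) := by
    rw [← Real.norm_eq_abs, ← Complex.norm_real, hφ.linearCombination_eq_integral]
    refine (norm_integral_le_integral_norm _).trans_eq (integral_congr_ae (ae_of_all _ fun w => ?_))
    have := (hsq w).ne'
    simp only [norm_mul]
    field_simp
  calc (Finsupp.linearCombination ℝ (fun x : unitInterval => φ x) a) ^ 2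
      = |Finsupp.linearCombination ℝ (fun x : unitInterval => φ x) a| ^ 2 := (sq_abs _).symm
    _ ≤ _ := pow_le_pow_left₀ (abs_nonneg _) habs 2
    _ ≤ _ := hcs
    _ ≤ _ := mul_le_mul hle hB (integral_nonneg fun w => by positivity)
      (hle.trans' (integral_nonneg fun w => by positivity))

/-! ### Poincaré inequalities -/

namespace IsTestFunction

variable {φ : ℝ → ℝ}

/-- A test function vanishes at the endpoints, so on `[0,1]` its values are bounded by the norm of its
derivative. -/
lemma sq_le_integral_deriv_sq (hφ : IsTestFunction φ) (x : ℝ) :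
    φ x ^ 2 ≤ ∫ y, deriv φ y ^ 2 ∂unitVolume := by
  by_cases hx : x ∈ Ioo (0 : ℝ) 1
  swap
  · rw [hφ.eq_zero_of_notMem hx, zero_pow two_ne_zero]
    exact integral_nonneg fun y => sq_nonneg _
  have hd : Continuous (deriv φ) := hφ.deriv.contDiff.continuous
  have e : φ x = ∫ y in (0 : ℝ)..x, deriv φ y := by
    rw [intervalIntegral.integral_deriv_eq_sub
      (fun y _ => (hφ.contDiff.differentiable (by simp)).differentiableAt)
      (hd.intervalIntegrable _ _), hφ.eq_zero_of_notMem (x := 0) (by simp), sub_zero]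
  have h1 : |φ x| ≤ ∫ y, |deriv φ y| ∂unitVolume := by
    rw [e, integral_unitVolume_eq_intervalIntegral (fun y => |deriv φ y|)]
    refine (intervalIntegral.abs_integral_le_integral_abs hx.1.le).trans ?_
    exact intervalIntegral.integral_mono_interval le_rfl hx.1.le hx.2.le
      (ae_of_all _ fun y => abs_nonneg _) (hd.abs.intervalIntegrable _ _)
  have h2 := sq_integral_mul_le (μ := unitVolume) (memLp_of_continuous hd.abs)
    (memLp_const (1 : ℝ)) (fun y => abs_nonneg _) (fun _ => zero_le_one)
  simp only [mul_one, sq_abs, one_pow, integral_const, probReal_univ, smul_eq_mul] at h2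
  rw [← sq_abs]
  exact (pow_le_pow_left₀ (abs_nonneg _) h1 2).trans h2

lemma sq_le_integral_iteratedDeriv_sq (hφ : IsTestFunction φ) {m : ℕ} (hm : 0 < m) (x : ℝ) :
    φ x ^ 2 ≤ ∫ y, iteratedDeriv m φ y ^ 2 ∂unitVolume := by
  induction m, hm using Nat.le_induction generalizing x with
  | base => simpa using hφ.sq_le_integral_deriv_sq x
  | succ k hk ih =>
    refine (ih x).trans ?_
    rw [iteratedDeriv_succ]
    calc ∫ y, iteratedDeriv k φ y ^ 2 ∂unitVolume
        ≤ ∫ _, (∫ z, deriv (iteratedDeriv k φ) z ^ 2 ∂unitVolume) ∂unitVolume :=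
          integral_mono (integrable_of_continuous ((hφ.continuous_iteratedDeriv k).pow 2))
            (integrable_const _) fun y => (hφ.iteratedDeriv k).sq_le_integral_deriv_sq y
      _ = _ := by simp

lemma integral_sq_le_integral_iteratedDeriv_sq (hφ : IsTestFunction φ) {m : ℕ} (hm : 0 < m) :
    ∫ x, φ x ^ 2 ∂unitVolume ≤ ∫ y, iteratedDeriv m φ y ^ 2 ∂unitVolume := by
  calc ∫ x, φ x ^ 2 ∂unitVolume
      ≤ ∫ _, (∫ y, iteratedDeriv m φ y ^ 2 ∂unitVolume) ∂unitVolume :=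
        integral_mono (integrable_of_continuous (hφ.contDiff.continuous.pow 2))
          (integrable_const _) fun y => hφ.sq_le_integral_iteratedDeriv_sq hm y
    _ = _ := by simp

end IsTestFunction

/-! ### Existence of an admissible constant -/

lemma eLpNorm_toReal_eq_sqrt {f : ℝ → ℝ} {μ : Measure ℝ} (hf : MemLp f 2 μ) :
    (eLpNorm f 2 μ).toReal = √(∫ x, f x ^ 2 ∂μ) := by
  rw [hf.eLpNorm_eq_integral_rpow_norm (by norm_num) (by norm_num), ENNReal.toReal_ofReal
    (by positivity), Real.sqrt_eq_rpow]
  simp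

lemma norm_toLp_eq_sqrt {f : ℝ → ℝ} {μ : Measure ℝ} (hf : MemLp f 2 μ) :
    ‖hf.toLp f‖ = √(∫ x, f x ^ 2 ∂μ) := by
  rw [Lp.norm_toLp, eLpNorm_toReal_eq_sqrt hf]

lemma sobolevNorm_bound {m k : ℕ} (hk : k ≤ m) (u : ℝ → ℝ) :
    √(∫ x, weakDeriv k u x ^ 2 ∂unitVolume) ≤ sobolevNorm m u :=
  Real.sqrt_le_sqrt (Finset.single_le_sum
    (f := fun k => ∫ x, weakDeriv k u x ^ 2 ∂unitVolume)
    (fun _ _ => integral_nonneg fun _ => sq_nonneg _) (Finset.mem_range.2 (by omega)))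

/-- A continuous representative of an element of `W_0^{m,2}(0,1)` is the pointwise limit on `[0,1]`
of test functions whose `m`-th derivatives converge in `L²`. -/
lemma MemSobolevZero.exists_approx {m : ℕ} (hm : 0 < m) {u : ℝ → ℝ} (huc : ContinuousOn u (Icc (0 : ℝ) 1))
    (hu : MemSobolevZero m u) :
    ∃ φ : ℕ → ℝ → ℝ, (∀ n, IsTestFunction (φ n)) ∧
      (∀ x ∈ Icc (0 : ℝ) 1, Tendsto (fun n => φ n x) atTop (𝓝 (u x))) ∧
      Tendsto (fun n => √(∫ x, iteratedDeriv m (φ n) x ^ 2 ∂unitVolume)) atTop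
        (𝓝 (sobolevSeminorm m u)) := by
  obtain ⟨hS, φ, hφ, hlim⟩ := hu
  refine ⟨φ, hφ, ?_⟩
  have hu2 := hS.1
  have hφ2 : ∀ n k, MemLp (iteratedDeriv k (φ n)) 2 unitVolume := fun n k =>
    memLp_of_continuous ((hφ n).continuous_iteratedDeriv k)
  have hconv : ∀ k ≤ m, ∀ v, MemLp v 2 unitVolume → IsWeakDeriv k u v →
      Tendsto (fun n => √(∫ x, (v x - iteratedDeriv k (φ n) x) ^ 2 ∂unitVolume)) atTop (𝓝 0) := by
    intro k hk v hv hvw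
    refine squeeze_zero (fun _ => Real.sqrt_nonneg _) (fun n => ?_) hlim
    refine le_trans (le_of_eq ?_) (sobolevNorm_bound hk _)
    congr 1
    refine integral_congr_ae ((weakDeriv_ae_eq (hv.sub (hφ2 n k)) (IsWeakDeriv.sub hvw
      (isWeakDeriv_iteratedDeriv (hφ n).contDiff k) hu2 (hφ2 n 0) hv (hφ2 n k))).mono
        fun x hx => ?_)
    simp [hx]
  obtain ⟨hv2, hvw⟩ := hS.weakDeriv_spec (le_refl m)
  set v := weakDeriv m u
  let V := hv2.toLp v
  let W : ℕ → Lp ℝ 2 unitVolume := fun n => (hφ2 n m).toLp _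
  have hVW : Tendsto W atTop (𝓝 V) := by
    rw [tendsto_iff_norm_sub_tendsto_zero]
    refine (hconv m le_rfl v hv2 hvw).congr fun n => ?_
    rw [norm_sub_rev, ← MemLp.toLp_sub, norm_toLp_eq_sqrt]
    rfl
  have hpair : ∀ n l x, |φ l x - φ n x| ≤ ‖W l - W n‖ := by
    intro n l x
    rw [← MemLp.toLp_sub, norm_toLp_eq_sqrt, ← Real.sqrt_sq_eq_abs]
    refine Real.sqrt_le_sqrt ((((hφ l).sub (hφ n)).sq_le_integral_iteratedDeriv_sq hm x).trans_eq ?_)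
    congr 1
    funext y
    congr 1
    exact iteratedDeriv_sub ((hφ l).contDiff.contDiffAt.of_le (by exact_mod_cast le_top))
      ((hφ n).contDiff.contDiffAt.of_le (by exact_mod_cast le_top))
  have h0 : IsWeakDeriv 0 u u := by intro ψ _; simp
  have hmeas : TendstoInMeasure unitVolume φ atTop u := by
    refine tendstoInMeasure_of_tendsto_eLpNorm (p := 2) (by norm_num)
      (fun n => (hφ n).contDiff.continuous.aestronglyMeasurable) hu2.1 ?_
    have h := ENNReal.tendsto_ofReal (hconv 0 (Nat.zero_le _) u hu2 h0)
    rw [ENNReal.ofReal_zero] at h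
    refine h.congr fun n => ?_
    have hs := hu2.sub (hφ2 n 0)
    have e := eLpNorm_toReal_eq_sqrt hs
    simp only [Pi.sub_apply] at e
    rw [← e, ENNReal.ofReal_toReal hs.2.ne, eLpNorm_sub_comm, iteratedDeriv_zero]
  obtain ⟨ns, hns, hae⟩ := hmeas.exists_seq_tendsto_ae
  have hbound : ∀ n, ∀ x ∈ Icc (0 : ℝ) 1, |u x - φ n x| ≤ ‖V - W n‖ := by
    intro n
    have hae' : ∀ᵐ x ∂unitVolume, |u x - φ n x| ≤ ‖V - W n‖ := by
      filter_upwards [hae] with x hx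
      refine le_of_tendsto_of_tendsto ((hx.sub_const _).abs)
        (((hVW.comp hns.tendsto_atTop).sub_const (W n)).norm) (Eventually.of_forall fun l => ?_)
      exact hpair n (ns l) x
    -- an inequality between continuous functions extends from almost every to every point
    have hc : ContinuousOn (fun x => |u x - φ n x|) (Icc 0 1) :=
      (huc.sub (hφ n).contDiff.continuous.continuousOn).abs
    have he := Measure.eqOn_Icc_of_ae_eq (μ := volume) (zero_ne_one (α := ℝ))
      (f := fun x => min |u x - φ n x| ‖V - W n‖) (g := fun x => |u x - φ n x|)
      (by
        rw [← restrict_Ioo_eq_restrict_Icc]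
        exact hae'.mono fun x hx => min_eq_left hx)
      (hc.inf continuousOn_const) hc
    exact fun x hx => min_eq_left_iff.1 (he hx)
  constructor
  · intro x hx
    rw [tendsto_iff_norm_sub_tendsto_zero]
    have : Tendsto (fun n => ‖V - W n‖) atTop (𝓝 0) := by
      simpa [norm_sub_rev] using tendsto_iff_norm_sub_tendsto_zero.1 hVW
    refine squeeze_zero (fun _ => norm_nonneg _) (fun n => ?_) this
    rw [norm_sub_rev]
    exact hbound n x hx
  · have := hVW.norm
    simp only [W, V, norm_toLp_eq_sqrt] at this
    exact this

/-- Every translation-invariant kernel with Fourier decay of order `m ≥ 1` has an upper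
norm-equivalence constant. -/
lemma exists_isNormEquivUpper {κ : ℝ → ℝ} {m : ℕ} (hm : 0 < m) (hκ : HasFourierDecay κ m)
    (H : Type*) [NormedAddCommGroup H] [InnerProductSpace ℝ H] [CompleteSpace H]
    [RKHS ℝ H unitInterval ℝ] (hH : IsRKHSOf H κ) :
    ∃ c : ℝ, 0 < c ∧ IsNormEquivUpper H m c := by
  obtain ⟨c₁, c₂, hc₁, -, hb⟩ := hκ.decay
  refine ⟨√(2 ^ m * 2 * c₁⁻¹), by positivity, fun u huc hu => ?_⟩
  obtain ⟨φ, hφ, hpt, hsemi⟩ := hu.exists_approx hm huc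
  refine exists_mem_rkhs_of_bound (fun x : unitInterval => u x)
    (mul_nonneg (Real.sqrt_nonneg _) (Real.sqrt_nonneg _)) fun a => ?_
  set N := ‖Finsupp.linearCombination ℝ (fun x => RKHS.kerFun H x (1 : ℝ)) a‖ with hN
  have hN2 : N ^ 2 = ∑ x ∈ a.support, ∑ y ∈ a.support, a x * a y * κ ((x : ℝ) - y) := by
    rw [hN, norm_linearCombination_kerFun_sq]
    simp_rw [hH _ _]
  have hn : ∀ n, |Finsupp.linearCombination ℝ (fun x : unitInterval => φ n x) a| ≤
      √(2 ^ m * 2 * c₁⁻¹) * √(∫ x, iteratedDeriv m (φ n) x ^ 2 ∂unitVolume) * N := by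
    intro n
    rw [← Real.sqrt_mul (by positivity), ← Real.sqrt_sq_eq_abs]
    refine Real.sqrt_le_iff.2 ⟨mul_nonneg (Real.sqrt_nonneg _) (norm_nonneg _), ?_⟩
    have hI : 0 ≤ ∫ x, iteratedDeriv m (φ n) x ^ 2 ∂unitVolume :=
      integral_nonneg fun _ => sq_nonneg _
    rw [mul_pow, Real.sq_sqrt (mul_nonneg (by positivity) hI)]
    refine (sq_linearCombination_le hm hκ hc₁ (fun w => (hb w).1) (hφ n) a).trans ?_
    rw [← hN2]
    have := (hφ n).integral_sq_le_integral_iteratedDeriv_sq hm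
    have h2 : (0 : ℝ) ≤ c₁⁻¹ * N ^ 2 := by positivity
    have h3 : (0 : ℝ) < 2 ^ m := by positivity
    calc _ ≤ 2 ^ m * (2 * ∫ x, iteratedDeriv m (φ n) x ^ 2 ∂unitVolume) * (c₁⁻¹ * N ^ 2) := by
          refine mul_le_mul_of_nonneg_right (mul_le_mul_of_nonneg_left ?_ h3.le) h2
          linarith
      _ = _ := by ring
  have hl : Tendsto (fun n => Finsupp.linearCombination ℝ (fun x : unitInterval => φ n x) a) atTop
      (𝓝 (Finsupp.linearCombination ℝ (fun x : unitInterval => u x) a)) := by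
    simp only [Finsupp.linearCombination_apply, Finsupp.sum]
    exact tendsto_finsetSum _ fun x _ => (hpt x x.2).const_smul (a x)
  exact le_of_tendsto_of_tendsto' hl.abs ((hsemi.const_mul _).mul_const N) hn

lemma sobolevSeminorm_nonneg (m : ℕ) (u : ℝ → ℝ) : 0 ≤ sobolevSeminorm m u := Real.sqrt_nonneg _

lemma IsNormEquivUpper.mono {H : Type*} [NormedAddCommGroup H] [InnerProductSpace ℝ H]
    [RKHS ℝ H unitInterval ℝ] {m : ℕ} {c c' : ℝ} (h : IsNormEquivUpper H m c) (hc : c ≤ c') :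
    IsNormEquivUpper H m c' := fun u huc hu => by
  obtain ⟨g, hg, hn⟩ := h u huc hu
  exact ⟨g, hg, hn.trans (mul_le_mul_of_nonneg_right hc (sobolevSeminorm_nonneg _ _))⟩

/-! ### An information inequality -/

/-- The Donsker–Varadhan inequality combined with Hoeffding's lemma: if `Q` has density `e^L` with
respect to `P`, then the relative entropy `-E_P[L]` controls the change of the mean of a bounded
variable. Optimized over `r` this is Pinsker's inequality. -/
lemma mul_integral_sub_le {Ω : Type*} [MeasurableSpace Ω] {P Q : Measure Ω}
    [IsProbabilityMeasure P] [IsProbabilityMeasure Q] {L Z : Ω → ℝ} (hL : Measurable L)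
    (hLi : Integrable L P) (hQ : Q = P.withDensity fun x => ENNReal.ofReal (Real.exp (L x)))
    (hZ : Measurable Z) {b : ℝ} (hZb : ∀ x, Z x ∈ Icc 0 b) (r : ℝ) :
    r * (∫ x, Z x ∂P - ∫ x, Z x ∂Q) ≤ -∫ x, L x ∂P + (b / 2) ^ 2 * r ^ 2 / 2 := by
  set q := ∫ x, Z x ∂Q with hq
  have hsub := hasSubgaussianMGF_of_mem_Icc (μ := Q) hZ.aemeasurable (ae_of_all _ hZb)
  have hmgf := hsub.mgf_le r
  have hint := hsub.integrable_exp_mul r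
  rw [mgf] at hmgf
  have hdens : Measurable fun x => ENNReal.ofReal (Real.exp (L x)) := by fun_prop
  have hfin : ∀ᵐ x ∂P, ENNReal.ofReal (Real.exp (L x)) < ⊤ :=
    ae_of_all _ fun _ => ENNReal.ofReal_lt_top
  have htoReal : ∀ x, (ENNReal.ofReal (Real.exp (L x))).toReal = Real.exp (L x) := fun x =>
    ENNReal.toReal_ofReal (Real.exp_pos _).le
  have hcomb : ∀ x, Real.exp (L x) * Real.exp (r * (Z x - q)) =
      Real.exp (r * (Z x - q) + L x) := fun x => by rw [← Real.exp_add, add_comm]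
  have hint' : Integrable (fun x => Real.exp (r * (Z x - q) + L x)) P := by
    rw [hQ, integrable_withDensity_iff_integrable_smul' hdens hfin] at hint
    simp only [htoReal, smul_eq_mul] at hint
    rw [← hQ] at hint
    simpa only [← hcomb] using hint
  have heq : ∫ x, Real.exp (r * (Z x - q)) ∂Q = ∫ x, Real.exp (r * (Z x - q) + L x) ∂P := by
    conv_lhs => rw [hQ]
    rw [integral_withDensity_eq_integral_toReal_smul hdens hfin]
    simp only [htoReal, smul_eq_mul, hcomb]
  have hZP : Integrable Z P := Integrable.of_mem_Icc 0 b hZ.aemeasurable (ae_of_all _ hZb)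
  have hZq : Integrable (fun x => r * (Z x - q)) P :=
    (hZP.sub (integrable_const q)).const_mul r
  have hXi : Integrable (fun x => r * (Z x - q) + L x) P := hZq.add hLi
  set m := ∫ x, (r * (Z x - q) + L x) ∂P with hm
  have hmval : m = r * (∫ x, Z x ∂P - q) + ∫ x, L x ∂P := by
    rw [hm, integral_add hZq hLi, integral_const_mul,
      integral_sub hZP (integrable_const q)]
    simp
  -- Jensen's inequality, from the tangent of the exponential at the mean `m`
  have hXm : Integrable (fun x => (r * (Z x - q) + L x) - m) P := hXi.sub (integrable_const m)
  have hjensen : Real.exp m ≤ ∫ x, Real.exp (r * (Z x - q) + L x) ∂P := by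
    have h1 : ∫ x, Real.exp m * (1 + ((r * (Z x - q) + L x) - m)) ∂P = Real.exp m := by
      rw [integral_const_mul, integral_add (integrable_const _) hXm,
        integral_sub hXi (integrable_const _)]
      simp [← hm]
    rw [← h1]
    refine integral_mono (((integrable_const _).add hXm).const_mul _)
      hint' fun x => ?_
    have := Real.add_one_le_exp ((r * (Z x - q) + L x) - m)
    calc Real.exp m * (1 + ((r * (Z x - q) + L x) - m))
        ≤ Real.exp m * Real.exp ((r * (Z x - q) + L x) - m) :=
          mul_le_mul_of_nonneg_left (by linarith) (Real.exp_pos _).le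
      _ = Real.exp (r * (Z x - q) + L x) := by rw [← Real.exp_add]; congr 1; ring
  have hfinal := hjensen.trans (heq ▸ hmgf)
  rw [Real.exp_le_exp, hmval] at hfinal
  have hb : (((‖b - 0‖₊ / 2) ^ 2 : ℝ≥0) : ℝ) = (b / 2) ^ 2 := by
    push_cast
    rw [sub_zero, Real.norm_eq_abs, div_pow, sq_abs, div_pow]
  rw [hb] at hfinal
  linarith

/-- Translating the noise `N(0,1/4)` by `d` has density `exp (4 e d - 2 d²)`. -/
lemma lintegral_gaussianReal_add (g : ℝ → ℝ≥0∞) (hg : Measurable g) (d : ℝ) :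
    ∫⁻ e, g (d + e) ∂(gaussianReal 0 (1 / 4)) =
      ∫⁻ e, g e * ENNReal.ofReal (Real.exp (4 * e * d - 2 * d ^ 2)) ∂(gaussianReal 0 (1 / 4)) := by
  have hv : (1 / 4 : ℝ≥0) ≠ 0 := by norm_num
  rw [← lintegral_map (f := g) (g := fun e => d + e) hg (by fun_prop), gaussianReal_map_const_add,
    zero_add, gaussianReal_of_var_ne_zero _ hv, gaussianReal_of_var_ne_zero _ hv,
    lintegral_withDensity_eq_lintegral_mul _ (measurable_gaussianPDF _ _) hg,
    lintegral_withDensity_eq_lintegral_mul _ (measurable_gaussianPDF _ _) (by fun_prop)]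
  congr 1
  funext e
  simp only [Pi.mul_apply]
  rw [mul_left_comm, mul_comm (gaussianPDF d (1 / 4) e)]
  congr 1
  rw [gaussianPDF, gaussianPDF, ← ENNReal.ofReal_mul (gaussianPDFReal_nonneg _ _ _)]
  congr 1
  rw [gaussianPDFReal, gaussianPDFReal, mul_assoc (√_)⁻¹, ← Real.exp_add]
  congr 2
  push_cast
  ring

/-! ### The law of the history -/

namespace Algorithm

variable (π : Algorithm) {f f₀ f₁ : unitInterval → ℝ} {ξ : Measure ℝ}

instance (t : ℕ) : IsMarkovKernel (π.policy t) := π.isMarkovKernel t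

/-- Appending a round to the history: the noise `p.2` is added to the reward of `p.1.2`. -/
def extend (f : unitInterval → ℝ) (t : ℕ)
    (p : ((Fin t → unitInterval × ℝ) × unitInterval) × ℝ) : Fin (t + 1) → unitInterval × ℝ :=
  Fin.snoc (α := fun _ => unitInterval × ℝ) p.1.1 (p.1.2, f p.1.2 + p.2)

lemma extend_castSucc (f : unitInterval → ℝ) (t : ℕ)
    (p : ((Fin t → unitInterval × ℝ) × unitInterval) × ℝ) (s : Fin t) :
    extend f t p s.castSucc = p.1.1 s := by
  simp [extend]

lemma extend_last (f : unitInterval → ℝ) (t : ℕ)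
    (p : ((Fin t → unitInterval × ℝ) × unitInterval) × ℝ) :
    extend f t p (Fin.last t) = (p.1.2, f p.1.2 + p.2) := by
  simp [extend]

lemma measurable_extend (hf : Measurable f) (t : ℕ) : Measurable (extend f t) := by
  refine measurable_pi_iff.2 fun s => ?_
  refine Fin.lastCases ?_ (fun s => ?_) s
  · simp_rw [extend_last]
    fun_prop
  · simp_rw [extend_castSucc]
    fun_prop

lemma law_succ (f : unitInterval → ℝ) (ξ : Measure ℝ) (t : ℕ) :
    π.law f ξ (t + 1) = (((π.law f ξ t) ⊗ₘ (π.policy t)).prod ξ).map (extend f t) := rfl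

lemma isProbabilityMeasure_law (hf : Measurable f) [IsProbabilityMeasure ξ] (t : ℕ) :
    IsProbabilityMeasure (π.law f ξ t) := by
  induction t with
  | zero => rw [law]; infer_instance
  | succ t ih =>
    rw [law_succ]
    exact Measure.isProbabilityMeasure_map (measurable_extend hf t).aemeasurable

lemma lintegral_law_succ (hf : Measurable f) [IsProbabilityMeasure ξ] (t : ℕ)
    {G : (Fin (t + 1) → unitInterval × ℝ) → ℝ≥0∞} (hG : Measurable G) :
    ∫⁻ h, G h ∂(π.law f ξ (t + 1)) =
      ∫⁻ h, ∫⁻ a, ∫⁻ e, G (extend f t ((h, a), e)) ∂ξ ∂(π.policy t h) ∂(π.law f ξ t) := by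
  have := π.isProbabilityMeasure_law (ξ := ξ) hf t
  have hm := measurable_extend hf t
  have hGm : Measurable fun p => G (extend f t p) := hG.comp hm
  rw [law_succ, lintegral_map hG hm, lintegral_prod _ hGm.aemeasurable,
    Measure.lintegral_compProd hGm.lintegral_prod_right']

/-- The log-likelihood ratio of the histories under the rewards `f₁` and `f₀`, for noise
`N(0,1/4)`. -/
def logRatio (f₀ f₁ : unitInterval → ℝ) (t : ℕ) (h : Fin t → unitInterval × ℝ) : ℝ :=
  ∑ s, (4 * ((h s).2 - f₀ (h s).1) * (f₁ (h s).1 - f₀ (h s).1) - 2 * (f₁ (h s).1 - f₀ (h s).1) ^ 2)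

lemma measurable_logRatio (hf₀ : Measurable f₀) (hf₁ : Measurable f₁) (t : ℕ) :
    Measurable (logRatio f₀ f₁ t) := by
  unfold logRatio; fun_prop

lemma logRatio_extend (t : ℕ) (p : ((Fin t → unitInterval × ℝ) × unitInterval) × ℝ) :
    logRatio f₀ f₁ (t + 1) (extend f₀ t p) = logRatio f₀ f₁ t p.1.1 +
      (4 * p.2 * (f₁ p.1.2 - f₀ p.1.2) - 2 * (f₁ p.1.2 - f₀ p.1.2) ^ 2) := by
  simp only [logRatio, Fin.sum_univ_castSucc, extend_castSucc, extend_last, add_sub_cancel_left]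

lemma lintegral_law_change (hf₀ : Measurable f₀) (hf₁ : Measurable f₁) (t : ℕ)
    {G : (Fin t → unitInterval × ℝ) → ℝ≥0∞} (hG : Measurable G) :
    ∫⁻ h, G h ∂(π.law f₁ (gaussianReal 0 (1 / 4)) t) =
      ∫⁻ h, ENNReal.ofReal (Real.exp (logRatio f₀ f₁ t h)) * G h
        ∂(π.law f₀ (gaussianReal 0 (1 / 4)) t) := by
  induction t with
  | zero => simp [law, logRatio]
  | succ t ih =>
    have hl := measurable_logRatio hf₀ hf₁ (t + 1)
    have hm : Measurable fun p : ((Fin t → unitInterval × ℝ) × unitInterval) × ℝ =>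
        G (extend f₁ t p) := hG.comp (measurable_extend hf₁ t)
    have hm0 : Measurable fun p : ((Fin t → unitInterval × ℝ) × unitInterval) × ℝ =>
        G (extend f₀ t p) := hG.comp (measurable_extend hf₀ t)
    have hshift : ∀ (h : Fin t → unitInterval × ℝ) (a : unitInterval),
        ∫⁻ e, G (extend f₁ t ((h, a), e)) ∂(gaussianReal 0 (1 / 4)) =
          ∫⁻ e, G (extend f₀ t ((h, a), e)) * ENNReal.ofReal
            (Real.exp (4 * e * (f₁ a - f₀ a) - 2 * (f₁ a - f₀ a) ^ 2))
              ∂(gaussianReal 0 (1 / 4)) := by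
      intro h a
      rw [← lintegral_gaussianReal_add (fun e => G (extend f₀ t ((h, a), e)))
        (hm0.comp (measurable_const.prodMk measurable_id))]
      refine lintegral_congr fun e => ?_
      have : extend f₁ t ((h, a), e) = extend f₀ t ((h, a), f₁ a - f₀ a + e) := by
        simp only [extend]
        congr 2
        ring
      rw [this]
    have hG' : Measurable fun h => ENNReal.ofReal (Real.exp (logRatio f₀ f₁ (t + 1) h)) * G h :=
      hl.exp.ennreal_ofReal.mul hG
    have hinner : Measurable fun p : (Fin t → unitInterval × ℝ) × unitInterval =>
        ∫⁻ e, G (extend f₁ t (p, e)) ∂(gaussianReal 0 (1 / 4)) := hm.lintegral_prod_right'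
    rw [π.lintegral_law_succ hf₁ t hG, ih hinner.lintegral_kernel_prod_right',
      π.lintegral_law_succ hf₀ t hG']
    refine lintegral_congr fun h => ?_
    have hinner' : Measurable fun a =>
        ∫⁻ e, G (extend f₁ t ((h, a), e)) ∂(gaussianReal 0 (1 / 4)) :=
      hinner.comp measurable_prodMk_left
    rw [← lintegral_const_mul _ hinner']
    refine lintegral_congr fun a => ?_
    rw [hshift, ← lintegral_const_mul]
    · refine lintegral_congr fun e => ?_
      rw [logRatio_extend, Real.exp_add, ENNReal.ofReal_mul (Real.exp_pos _).le]
      ring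
    · exact (hm0.comp (measurable_const.prodMk measurable_id)).mul (by fun_prop)

lemma law_eq_withDensity (hf₀ : Measurable f₀) (hf₁ : Measurable f₁) (t : ℕ) :
    π.law f₁ (gaussianReal 0 (1 / 4)) t = (π.law f₀ (gaussianReal 0 (1 / 4)) t).withDensity
      fun h => ENNReal.ofReal (Real.exp (logRatio f₀ f₁ t h)) := by
  have hl := measurable_logRatio hf₀ hf₁ t
  refine Measure.ext fun s hs => ?_
  rw [withDensity_apply _ hs, ← lintegral_indicator_one hs,
    π.lintegral_law_change hf₀ hf₁ t (measurable_one.indicator hs), ← lintegral_indicator hs]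
  refine lintegral_congr fun h => ?_
  by_cases hh : h ∈ s <;> simp [hh]

/-- Predictable multiples of the noise form martingale differences, hence have mean zero. -/
lemma integral_noise (hf : Measurable f) [IsProbabilityMeasure ξ] (hξ : Integrable (fun x => x) ξ)
    (hξ0 : ∫ x, x ∂ξ = 0) {c : unitInterval → ℝ} (hc : Measurable c) {C : ℝ} (hC : ∀ a, |c a| ≤ C)
    (t : ℕ) :
    Integrable (fun h : Fin t → unitInterval × ℝ => ∑ s, c (h s).1 * ((h s).2 - f (h s).1))
      (π.law f ξ t) ∧
    ∫ h, ∑ s, c (h s).1 * ((h s).2 - f (h s).1) ∂(π.law f ξ t) = 0 := by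
  induction t with
  | zero => simp
  | succ t ih =>
    have := π.isProbabilityMeasure_law (ξ := ξ) hf t
    obtain ⟨ih1, ih2⟩ := ih
    have hmp : MeasurePreserving Prod.fst ((π.law f ξ t) ⊗ₘ (π.policy t)) (π.law f ξ t) :=
      ⟨measurable_fst, Measure.fst_compProd _ _⟩
    have hmp2 : MeasurePreserving (fun p => p.1.1) (((π.law f ξ t) ⊗ₘ (π.policy t)).prod ξ)
      (π.law f ξ t) := hmp.comp measurePreserving_fst
    have i1 : Integrable (fun p : ((Fin t → unitInterval × ℝ) × unitInterval) × ℝ =>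
        ∑ s, c (p.1.1 s).1 * ((p.1.1 s).2 - f (p.1.1 s).1))
          (((π.law f ξ t) ⊗ₘ (π.policy t)).prod ξ) := hmp2.integrable_comp_of_integrable ih1
    have hci : Integrable (fun p : (Fin t → unitInterval × ℝ) × unitInterval => c p.2)
        ((π.law f ξ t) ⊗ₘ (π.policy t)) :=
      Integrable.of_bound (hc.comp measurable_snd).aestronglyMeasurable C
        (ae_of_all _ fun p => hC _)
    have i2 := hci.mul_prod hξ
    have e : ∀ p : ((Fin t → unitInterval × ℝ) × unitInterval) × ℝ,
        ∑ s, c (extend f t p s).1 * ((extend f t p s).2 - f (extend f t p s).1) =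
          ∑ s, c (p.1.1 s).1 * ((p.1.1 s).2 - f (p.1.1 s).1) + c p.1.2 * p.2 := by
      intro p
      simp [Fin.sum_univ_castSucc, extend_castSucc, extend_last]
    have hm := measurable_extend hf t
    have hF : Measurable fun h : Fin (t + 1) → unitInterval × ℝ =>
        ∑ s, c (h s).1 * ((h s).2 - f (h s).1) := by fun_prop
    rw [law_succ]
    constructor
    · rw [integrable_map_measure hF.aestronglyMeasurable hm.aemeasurable]
      refine (i1.add i2).congr (ae_of_all _ fun p => ?_)
      simp [e]
    · rw [integral_map hm.aemeasurable hF.aestronglyMeasurable]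
      simp_rw [e]
      have i1' : ∫ p : ((Fin t → unitInterval × ℝ) × unitInterval) × ℝ,
          ∑ s, c (p.1.1 s).1 * ((p.1.1 s).2 - f (p.1.1 s).1)
            ∂(((π.law f ξ t) ⊗ₘ (π.policy t)).prod ξ) = 0 := by
        have h := integral_map hmp2.measurable.aemeasurable
          (f := fun h : Fin t → unitInterval × ℝ => ∑ s, c (h s).1 * ((h s).2 - f (h s).1))
          (by rw [hmp2.map_eq]; exact ih1.aestronglyMeasurable)
        rw [hmp2.map_eq, ih2] at h
        exact h.symm
      rw [integral_add i1 i2, i1', zero_add]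
      refine (integral_prod_mul (fun p : (Fin t → unitInterval × ℝ) × unitInterval => c p.2)
        (fun x : ℝ => x)).trans ?_
      rw [hξ0, mul_zero]

/-- The occupation measure of the actions: the expected number of rounds in which the action lies in
a given set. -/
noncomputable def occupation (f : unitInterval → ℝ) (ξ : Measure ℝ) (T : ℕ) :
    Measure unitInterval :=
  ∑ t : Fin T, (π.law f ξ T).map fun h => (h t).1

lemma occupation_univ (hf : Measurable f) [IsProbabilityMeasure ξ] (T : ℕ) :
    π.occupation f ξ T univ = T := by
  have := π.isProbabilityMeasure_law (ξ := ξ) hf T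
  rw [occupation, Measure.finsetSum_apply]
  have : ∀ t : Fin T, Measurable fun h : Fin T → unitInterval × ℝ => (h t).1 := fun t => by fun_prop
  simp [Measure.map_apply (this _) MeasurableSet.univ]

lemma isFiniteMeasure_occupation (hf : Measurable f) [IsProbabilityMeasure ξ] (T : ℕ) :
    IsFiniteMeasure (π.occupation f ξ T) :=
  ⟨by rw [π.occupation_univ hf]; exact ENNReal.natCast_lt_top T⟩

lemma integral_sum_action (hf : Measurable f) [IsProbabilityMeasure ξ] {c : unitInterval → ℝ}
    (hc : Measurable c) {C : ℝ} (hC : ∀ a, |c a| ≤ C) (T : ℕ) :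
    Integrable (fun h : Fin T → unitInterval × ℝ => ∑ t, c (h t).1) (π.law f ξ T) ∧
    ∫ h, ∑ t, c (h t).1 ∂(π.law f ξ T) = ∫ a, c a ∂(π.occupation f ξ T) := by
  have := π.isProbabilityMeasure_law (ξ := ξ) hf T
  have hm : ∀ t : Fin T, Measurable fun h : Fin T → unitInterval × ℝ => (h t).1 := fun t => by
    fun_prop
  have hi : ∀ t : Fin T, Integrable (fun h : Fin T → unitInterval × ℝ => c (h t).1)
      (π.law f ξ T) := fun t =>
    Integrable.of_bound (hc.comp (hm t)).aestronglyMeasurable C (ae_of_all _ fun h => hC _)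
  refine ⟨integrable_finsetSum _ fun t _ => hi t, ?_⟩
  rw [integral_finsetSum _ fun t _ => hi t, occupation, integral_finsetSum_measure]
  · exact Finset.sum_congr rfl fun t _ =>
      (integral_map (hm t).aemeasurable hc.aestronglyMeasurable).symm
  · intro t _
    rw [integrable_map_measure hc.aestronglyMeasurable (hm t).aemeasurable]
    exact hi t

lemma expectedRegret_eq (hf : Measurable f) [IsProbabilityMeasure ξ] {C : ℝ}
    (hC : ∀ a, |f a| ≤ C) (T : ℕ) :
    π.expectedRegret f ξ T = ∫ a, ((⨆ b, f b) - f a) ∂(π.occupation f ξ T) := by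
  rw [expectedRegret, ← (π.integral_sum_action hf (c := fun a => (⨆ b, f b) - f a)
    (by fun_prop) (C := |⨆ b, f b| + C) (fun a => ?_) T).2]
  exact (abs_sub _ _).trans (by linarith [hC a])

/-- If the reward functions `f₀` and `f₁` differ little on the actions played under `f₀`, then the
occupation measures under `f₀` and `f₁` are close: `hkl` says that the relative entropy of the laws of
the histories is at most `1/4`. -/
lemma integral_occupation_sub_le (hf₀ : Measurable f₀) (hf₁ : Measurable f₁) {C : ℝ}
    (hC : ∀ a, |f₁ a - f₀ a| ≤ C) {z : unitInterval → ℝ} (hz : Measurable z)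
    (hzb : ∀ a, z a ∈ Icc (0 : ℝ) 2) (T : ℕ)
    (hkl : 2 * ∫ a, (f₁ a - f₀ a) ^ 2 ∂(π.occupation f₀ (gaussianReal 0 (1 / 4)) T) ≤ 1 / 4) :
    ∫ a, z a ∂(π.occupation f₀ (gaussianReal 0 (1 / 4)) T) -
      ∫ a, z a ∂(π.occupation f₁ (gaussianReal 0 (1 / 4)) T) ≤ 3 / 4 * T := by
  rcases Nat.eq_zero_or_pos T with rfl | hT
  · simp [occupation]
  have p0 := π.isProbabilityMeasure_law (ξ := gaussianReal 0 (1 / 4)) hf₀ T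
  have p1 := π.isProbabilityMeasure_law (ξ := gaussianReal 0 (1 / 4)) hf₁ T
  have hzabs : ∀ a, |z a| ≤ 2 := fun a => abs_le.2 ⟨by linarith [(hzb a).1], (hzb a).2⟩
  obtain ⟨-, z0⟩ := π.integral_sum_action (ξ := gaussianReal 0 (1 / 4)) hf₀ hz hzabs T
  obtain ⟨-, z1⟩ := π.integral_sum_action (ξ := gaussianReal 0 (1 / 4)) hf₁ hz hzabs T
  obtain ⟨d1, d2⟩ := π.integral_sum_action (ξ := gaussianReal 0 (1 / 4)) hf₀
    (c := fun a => (f₁ a - f₀ a) ^ 2) (by fun_prop) (C := C ^ 2) (fun a => by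
      rw [abs_pow]; exact pow_le_pow_left₀ (abs_nonneg _) (hC a) 2) T
  obtain ⟨n1, n2⟩ := π.integral_noise (ξ := gaussianReal 0 (1 / 4)) hf₀
    (memLp_id_gaussianReal 1 |>.integrable le_rfl) (by simp)
    (c := fun a => f₁ a - f₀ a) (by fun_prop) hC T
  have hlog : logRatio f₀ f₁ T = fun h =>
      4 * (∑ s, (f₁ (h s).1 - f₀ (h s).1) * ((h s).2 - f₀ (h s).1)) -
        2 * ∑ s, (f₁ (h s).1 - f₀ (h s).1) ^ 2 := by
    funext h
    rw [logRatio, Finset.mul_sum, Finset.mul_sum, ← Finset.sum_sub_distrib]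
    exact Finset.sum_congr rfl fun s _ => by ring
  have hLi : Integrable (logRatio f₀ f₁ T) (π.law f₀ (gaussianReal 0 (1 / 4)) T) := by
    rw [hlog]; exact (n1.const_mul 4).sub (d1.const_mul 2)
  have hLv : ∫ h, logRatio f₀ f₁ T h ∂(π.law f₀ (gaussianReal 0 (1 / 4)) T) =
      -(2 * ∫ a, (f₁ a - f₀ a) ^ 2 ∂(π.occupation f₀ (gaussianReal 0 (1 / 4)) T)) := by
    rw [hlog, integral_sub (n1.const_mul 4) (d1.const_mul 2), integral_const_mul,
      integral_const_mul, n2, d2]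
    ring
  have hT' : (0 : ℝ) < T := by exact_mod_cast hT
  -- `r = 7 / (10 T)` nearly minimizes `1 / (4 r) + T² r / 2`
  have key := mul_integral_sub_le (measurable_logRatio hf₀ hf₁ T) hLi
    (π.law_eq_withDensity hf₀ hf₁ T) (Z := fun h => ∑ t, z (h t).1) (by fun_prop) (b := 2 * T)
    (fun h => ⟨Finset.sum_nonneg fun t _ => (hzb _).1, by
      calc ∑ t, z (h t).1 ≤ ∑ _t : Fin T, (2 : ℝ) := Finset.sum_le_sum fun t _ => (hzb _).2
        _ = 2 * T := by simp [mul_comm]⟩) (7 / 10 / T)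
  rw [z0, z1, hLv, neg_neg] at key
  have e1 : (2 * (T : ℝ) / 2) ^ 2 * (7 / 10 / T) ^ 2 / 2 = 49 / 200 := by field_simp; norm_num
  rw [e1, div_mul_eq_mul_div, div_le_iff₀ hT'] at key
  nlinarith

/-- The lower bound for a base function `f₀` with a peak in `(1/2, 1]` and needles `g i` with
disjoint supports in `[0, 1/2]`. Small regret under `f₀` forces few visits to `[0, 1/2]`, so some
needle goes undetected; if it is present, the regret is linear in `T`. -/
theorem exists_regret_ge {D R : ℝ} (hD : 0 < D) {K : ℕ} (hK : 2 ≤ K) (hKR : 16 * R * D ≤ K)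
    (hf₀ : Measurable f₀) (hf₀0 : ∀ a, 0 ≤ f₀ a) (hf₀1 : ∀ a, f₀ a ≤ D / 2)
    (hf₀half : ∀ a : unitInterval, (a : ℝ) ≤ 1 / 2 → f₀ a = 0) (hf₀max : ∃ a, f₀ a = D / 2)
    {g : Fin K → unitInterval → ℝ} {A : Fin K → Set unitInterval} (hg : ∀ i, Measurable (g i))
    (hg0 : ∀ i a, 0 ≤ g i a) (hg1 : ∀ i a, g i a ≤ D) (hA : ∀ i, MeasurableSet (A i))
    (hAdisj : Pairwise (Function.onFun Disjoint A))
    (hAhalf : ∀ i, ∀ a ∈ A i, (a : ℝ) ≤ 1 / 2) (hgA : ∀ i, ∀ a ∉ A i, g i a = 0)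
    (hgmax : ∀ i, ∃ a, g i a = D) (T : ℕ)
    (hreg : π.expectedRegret f₀ (gaussianReal 0 (1 / 4)) T ≤ R) :
    ∃ i, 1 / 8 * D * T ≤
      π.expectedRegret (fun a => f₀ a + g i a) (gaussianReal 0 (1 / 4)) T := by
  set μ := π.occupation f₀ (gaussianReal 0 (1 / 4)) T with hμ
  have hfin : IsFiniteMeasure μ := π.isFiniteMeasure_occupation hf₀ T
  have hTot : μ.real univ = T := by
    rw [measureReal_def, hμ, π.occupation_univ hf₀, ENNReal.toReal_natCast]
  set U : Set unitInterval := {a | (a : ℝ) ≤ 1 / 2} with hU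
  have hUm : MeasurableSet U := measurableSet_le measurable_subtype_coe measurable_const
  have hmb : ∀ {ν : Measure unitInterval} [IsFiniteMeasure ν] {c : unitInterval → ℝ} {C : ℝ},
      Measurable c → (∀ a, |c a| ≤ C) → Integrable c ν := fun hc hC =>
    Integrable.of_bound hc.aestronglyMeasurable _ (ae_of_all _ hC)
  -- few visits to `[0, 1/2]` under `f₀`
  have hvis : D / 2 * μ.real U ≤ R := by
    refine le_trans ?_ hreg
    have hb : ∀ a, |f₀ a| ≤ D / 2 := fun a => by rw [abs_of_nonneg (hf₀0 a)]; exact hf₀1 a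
    rw [π.expectedRegret_eq hf₀ hb, ← hμ]
    obtain ⟨a₀, ha₀⟩ := hf₀max
    have hbdd : BddAbove (range f₀) := ⟨D / 2, by rintro _ ⟨a, rfl⟩; exact hf₀1 a⟩
    have hsup : D / 2 ≤ ⨆ b, f₀ b := ha₀ ▸ le_ciSup hbdd a₀
    have e : D / 2 * μ.real U = ∫ a, U.indicator (fun _ => D / 2) a ∂μ := by
      rw [integral_indicator_const _ hUm, smul_eq_mul, mul_comm]
    rw [e]
    refine integral_mono ((integrable_const _).indicator hUm)
      ((integrable_const _).sub (hmb hf₀ hb)) fun a => ?_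
    by_cases ha : a ∈ U
    · simp only [indicator_of_mem ha, hf₀half a ha]; linarith
    · simp only [indicator_of_notMem ha]; linarith [hf₀1 a]
  -- the least visited needle
  have hsum : ∑ i, μ.real (A i) ≤ μ.real U := by
    rw [← measureReal_biUnion_finset (fun i _ j _ hij => hAdisj hij) fun i _ => hA i]
    exact measureReal_mono (iUnion₂_subset fun i _ a ha => hAhalf i a ha)
  have hne : (Finset.univ : Finset (Fin K)).Nonempty := ⟨⟨0, by omega⟩, Finset.mem_univ _⟩
  obtain ⟨i, -, hi⟩ := Finset.exists_min_image Finset.univ (fun i => μ.real (A i)) hne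
  have hKi : K * μ.real (A i) ≤ μ.real U := by
    refine le_trans ?_ hsum
    calc (K : ℝ) * μ.real (A i) = ∑ _j : Fin K, μ.real (A i) := by simp
      _ ≤ _ := Finset.sum_le_sum fun j hj => hi j hj
  refine ⟨i, ?_⟩
  have hK' : (2 : ℝ) ≤ K := by exact_mod_cast hK
  have hn0 : 0 ≤ μ.real (A i) := measureReal_nonneg
  have hf₁ : Measurable fun a => f₀ a + g i a := hf₀.add (hg i)
  set ν := π.occupation (fun a => f₀ a + g i a) (gaussianReal 0 (1 / 4)) T with hν
  have hfin' : IsFiniteMeasure ν := π.isFiniteMeasure_occupation hf₁ T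
  have hgabs : ∀ a, |g i a| ≤ D := fun a => by rw [abs_of_nonneg (hg0 i a)]; exact hg1 i a
  have hkl : 2 * ∫ a, ((f₀ a + g i a) - f₀ a) ^ 2 ∂μ ≤ 1 / 4 := by
    have h1 : ∫ a, ((f₀ a + g i a) - f₀ a) ^ 2 ∂μ ≤ D ^ 2 * μ.real (A i) := by
      have e : D ^ 2 * μ.real (A i) = ∫ a, (A i).indicator (fun _ => D ^ 2) a ∂μ := by
        rw [integral_indicator_const _ (hA i), smul_eq_mul, mul_comm]
      rw [e]
      simp only [add_sub_cancel_left]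
      refine integral_mono (hmb (C := D ^ 2) ((hg i).pow_const 2) fun a => ?_)
        ((integrable_const _).indicator (hA i)) fun a => ?_
      · rw [abs_pow]; exact pow_le_pow_left₀ (abs_nonneg _) (hgabs a) 2
      · by_cases ha : a ∈ A i
        · simp only [indicator_of_mem ha]
          exact pow_le_pow_left₀ (hg0 i a) (hg1 i a) 2
        · simp [indicator_of_notMem ha, hgA i a ha]
    -- `16 R D n ≤ K n ≤ 2 R / D` for the number `n` of visits
    have h2 : D * (K * μ.real (A i)) ≤ 2 * R := by nlinarith
    rcases le_or_gt R 0 with hR | hR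
    · have : μ.real (A i) = 0 := by
        have : D * (K * μ.real (A i)) ≤ 0 := by linarith
        have hDK : 0 < D * K := by positivity
        nlinarith
      rw [this] at h1; linarith
    · have h3 : D * (16 * R * D * μ.real (A i)) ≤ 2 * R :=
        (mul_le_mul_of_nonneg_left (mul_le_mul_of_nonneg_right hKR hn0) hD.le).trans h2
      have h4 : D ^ 2 * μ.real (A i) ≤ 1 / 8 := by
        refine le_of_mul_le_mul_left ?_ (by positivity : 0 < 16 * R)
        linarith
      linarith
  -- weights bounding the regret from below, in units of `D / 2`
  set z : unitInterval → ℝ := fun a =>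
    2 - (A i).indicator (fun _ => (2 : ℝ)) a - Uᶜ.indicator (fun _ => (1 : ℝ)) a with hz
  have hcases : ∀ a, (a ∈ A i ∧ a ∈ U ∧ z a = 0) ∨ (a ∉ A i ∧ a ∈ U ∧ z a = 2) ∨
      (a ∉ A i ∧ a ∉ U ∧ z a = 1) := by
    intro a
    by_cases h1 : a ∈ A i
    · have h2 : a ∈ U := hAhalf i a h1
      left; simp [hz, h1, h2]
    · by_cases h2 : a ∈ U
      · right; left; simp [hz, h1, h2]
      · right; right; simp [hz, h1, h2]; norm_num
  have hzm : Measurable z := (measurable_const.sub (measurable_const.indicator (hA i))).sub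
    (measurable_const.indicator hUm.compl)
  have hzb : ∀ a, z a ∈ Icc (0 : ℝ) 2 := fun a => by
    rcases hcases a with ⟨-, -, h⟩ | ⟨-, -, h⟩ | ⟨-, -, h⟩ <;> rw [h] <;> norm_num
  have hzabs : ∀ a, |z a| ≤ 2 := fun a => abs_le.2 ⟨by linarith [(hzb a).1], (hzb a).2⟩
  have hz0 : (T : ℝ) ≤ ∫ a, z a ∂μ := by
    have e : ∫ a, z a ∂μ = 2 * T - 2 * μ.real (A i) - μ.real Uᶜ := by
      have i1 : Integrable (fun a => (A i).indicator (fun _ => (2 : ℝ)) a) μ :=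
        (integrable_const _).indicator (hA i)
      have i2 : Integrable (fun a => Uᶜ.indicator (fun _ => (1 : ℝ)) a) μ :=
        (integrable_const _).indicator hUm.compl
      have i3 : Integrable (fun a => 2 - (A i).indicator (fun _ => (2 : ℝ)) a) μ :=
        (integrable_const _).sub i1
      rw [hz, integral_sub i3 i2, integral_sub (integrable_const _) i1,
        integral_indicator_const _ (hA i), integral_indicator_const _ hUm.compl, integral_const,
        hTot]
      simp only [smul_eq_mul]
      ring
    have h1 : μ.real U + μ.real Uᶜ = T := by rw [measureReal_add_measureReal_compl hUm, hTot]
    have h2 : 2 * μ.real (A i) ≤ K * μ.real (A i) := mul_le_mul_of_nonneg_right hK' hn0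
    linarith
  have htrans := π.integral_occupation_sub_le hf₀ hf₁ (C := D)
    (fun a => by rw [add_sub_cancel_left]; exact hgabs a) hzm hzb T hkl
  rw [← hμ, ← hν] at htrans
  have hf₁b : ∀ a, f₀ a + g i a ≤ D := by
    intro a
    rcases hcases a with ⟨h1, h2, -⟩ | ⟨h1, h2, -⟩ | ⟨h1, -, -⟩
    · rw [hf₀half a h2]; linarith [hg1 i a]
    · rw [hgA i a h1]; linarith [hf₀1 a]
    · rw [hgA i a h1]; linarith [hf₀1 a]
  have hf₁abs : ∀ a, |f₀ a + g i a| ≤ D := fun a => by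
    rw [abs_of_nonneg (add_nonneg (hf₀0 a) (hg0 i a))]; exact hf₁b a
  have hsup : D ≤ ⨆ b, (f₀ b + g i b) := by
    obtain ⟨a, ha⟩ := hgmax i
    have hbdd : BddAbove (range fun b => f₀ b + g i b) :=
      ⟨D, by rintro _ ⟨a, rfl⟩; exact hf₁b a⟩
    exact le_trans (by linarith [hf₀0 a]) (le_ciSup hbdd a)
  rw [π.expectedRegret_eq hf₁ hf₁abs, ← hν]
  have hlow : D / 2 * ∫ a, z a ∂ν ≤ ∫ a, ((⨆ b, (f₀ b + g i b)) - (f₀ a + g i a)) ∂ν := by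
    rw [← integral_const_mul]
    refine integral_mono ((hmb hzm hzabs).const_mul _)
      ((integrable_const _).sub (hmb hf₁ hf₁abs)) fun a => ?_
    simp only
    rcases hcases a with ⟨h1, h2, h3⟩ | ⟨h1, h2, h3⟩ | ⟨h1, -, h3⟩
    · rw [h3]; linarith [hf₁b a]
    · rw [h3, hgA i a h1, hf₀half a h2]; linarith
    · rw [h3, hgA i a h1]; linarith [hf₀1 a]
  refine le_trans ?_ hlow
  have : (T : ℝ) / 4 ≤ ∫ a, z a ∂ν := by linarith
  calc 1 / 8 * D * T = D / 2 * (T / 4) := by ring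
    _ ≤ _ := mul_le_mul_of_nonneg_left this (by positivity)

end Algorithm

/-! ### Sobolev seminorms of the reward functions -/

lemma sobolevSeminorm_eq {u : ℝ → ℝ} (hu : ContDiff ℝ ∞ u) (m : ℕ) :
    sobolevSeminorm m u = √(∫ x, iteratedDeriv m u x ^ 2 ∂unitVolume) := by
  rw [sobolevSeminorm, integral_weakDeriv_sq hu]

/-- The definition of `C(m)`, cleared of roots. -/
lemma constC_pow {m : ℕ} (hm : 0 < m) :
    (4 * constC m) ^ (2 * m - 1) * bumpEnergy m = bumpMax ^ 2 := by
  have hI := bumpEnergy_pos m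
  have hm1 : (1 : ℝ) ≤ m := by exact_mod_cast hm
  have hp : (m : ℝ) - 1 / 2 ≠ 0 := by linarith
  have hcast : ((2 * m - 1 : ℕ) : ℝ) = 2 * (m : ℝ) - 1 := by
    rw [Nat.cast_sub (by omega)]; push_cast; ring
  have hX : 0 ≤ bumpMax / ((2 : ℝ) ^ (2 * (m : ℝ) - 1) * √(bumpEnergy m)) :=
    div_nonneg bumpMax_pos.le (by positivity)
  have h1 : constC m ^ (2 * m - 1) =
      (bumpMax / ((2 : ℝ) ^ (2 * m - 1) * √(bumpEnergy m))) ^ 2 := by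
    rw [constC, ← Real.rpow_natCast (_ ^ _), ← Real.rpow_mul hX, hcast]
    have e : 1 / ((m : ℝ) - 1 / 2) * (2 * (m : ℝ) - 1) = (2 : ℕ) := by
      rw [one_div, inv_mul_eq_div, div_eq_iff hp]
      push_cast
      ring
    rw [e, Real.rpow_natCast, ← hcast, Real.rpow_natCast]
  rw [mul_pow, h1, div_pow, mul_pow, Real.sq_sqrt hI.le, ← pow_mul, mul_comm (2 * m - 1) 2, pow_mul]
  norm_num
  field_simp

lemma integral_iteratedDeriv_scaledBump_sq_eq_constC {m : ℕ} (hm : 0 < m) {a c h : ℝ} (hh : 0 < h)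
    (h0 : 0 ≤ c - h) (h1 : c + h ≤ 1) :
    ∫ x, iteratedDeriv m (scaledBump a c h) x ^ 2 ∂unitVolume =
      a ^ 2 * ((4 * h)⁻¹ / constC m) ^ (2 * m - 1) := by
  rw [integral_iteratedDeriv_scaledBump_sq hh h0 h1, div_pow a, ← constC_pow hm]
  have e : (h⁻¹ ^ m) ^ 2 * h = h⁻¹ ^ (2 * m - 1) := by
    obtain ⟨k, rfl⟩ : ∃ k, m = k + 1 := ⟨m - 1, by omega⟩
    have : 2 * (k + 1) - 1 = 2 * k + 1 := by omega
    rw [this, pow_succ h⁻¹ (2 * k), pow_succ h⁻¹ k, mul_pow, ← pow_mul, mul_comm k 2]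
    field_simp
  have hI := bumpEnergy_pos m
  have hC := constC_pos m
  rw [mul_assoc (_ / _), e, div_pow, mul_inv, mul_pow, mul_pow, inv_pow, inv_pow]
  field_simp

lemma integral_iteratedDeriv_add_sq {u v : ℝ → ℝ} (hu : ContDiff ℝ ∞ u) (hv : ContDiff ℝ ∞ v)
    (m : ℕ) (hd : ∀ᵐ x ∂unitVolume, iteratedDeriv m u x * iteratedDeriv m v x = 0) :
    ∫ x, iteratedDeriv m (fun x => u x + v x) x ^ 2 ∂unitVolume =
      ∫ x, iteratedDeriv m u x ^ 2 ∂unitVolume + ∫ x, iteratedDeriv m v x ^ 2 ∂unitVolume := by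
  have hi : ∀ {w : ℝ → ℝ}, ContDiff ℝ ∞ w →
      Integrable (fun x => iteratedDeriv m w x ^ 2) unitVolume := fun hw =>
    integrable_of_continuous ((continuous_iteratedDeriv_of_contDiff hw m).pow 2)
  rw [← integral_add (hi hu) (hi hv)]
  refine integral_congr_ae (hd.mono fun x hx => ?_)
  have e : iteratedDeriv m (fun x => u x + v x) x = iteratedDeriv m u x + iteratedDeriv m v x :=
    iteratedDeriv_add (hu.contDiffAt.of_le (by exact_mod_cast le_top))
      (hv.contDiffAt.of_le (by exact_mod_cast le_top))
  simp only [e]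
  linear_combination 2 * hx

/-! ### The height of the needles -/

/-- The height of the needles: the largest one for which roughly `32 R D` disjoint needles of height
`D` in `[0, 1/2]` fit into the ball of radius `B₁`. -/
noncomputable def needleHeight (m : ℕ) (cu R B₁ : ℝ) : ℝ :=
  (constC m / 32) ^ (((m : ℝ) - 1 / 2) / ((m : ℝ) + 1 / 2)) *
    (B₁ / cu) ^ (1 / ((m : ℝ) + 1 / 2)) * R ^ (-(((m : ℝ) - 1 / 2) / ((m : ℝ) + 1 / 2)))

section NeedleHeight

variable {m m₂ : ℕ} {cu R B₁ B₂ : ℝ}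

lemma needleHeight_pos (hcu : 0 < cu) (hR : 0 < R) (hB₁ : 0 < B₁) :
    0 < needleHeight m cu R B₁ := by
  have := constC_pos m
  unfold needleHeight
  positivity

lemma needleHeight_rpow (hcu : 0 < cu) (hR : 0 < R) (hB₁ : 0 < B₁) :
    needleHeight m cu R B₁ ^ ((m : ℝ) + 1 / 2) =
      (constC m / 32) ^ ((m : ℝ) - 1 / 2) * (B₁ / cu) * R ^ (-((m : ℝ) - 1 / 2)) := by
  have hC := constC_pos m
  have hq : (m : ℝ) + 1 / 2 ≠ 0 := by positivity
  unfold needleHeight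
  rw [Real.mul_rpow (by positivity) (by positivity), Real.mul_rpow (by positivity) (by positivity),
    ← Real.rpow_mul (by positivity), ← Real.rpow_mul (by positivity),
    ← Real.rpow_mul (by positivity), neg_mul, div_mul_cancel₀ _ hq, div_mul_cancel₀ _ hq,
    Real.rpow_one]

/-- The lower constraint on `B₁` says that there is room for three needles. -/
lemma three_le_needles (hcu : 0 < cu) (hR : 0 < R) (hB : AdmissibleRadii m m₂ cu R B₁ B₂) :
    3 ≤ 32 * R * needleHeight m cu R B₁ := by
  have hC := constC_pos m
  have hD := needleHeight_pos (m := m) hcu hR hB.pos₁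
  have hq : (0 : ℝ) < (m : ℝ) + 1 / 2 := by positivity
  have hlow : (3 : ℝ) ^ ((m : ℝ) + 1 / 2) / 32 * constC m ^ (-((m : ℝ) - 1 / 2)) * R⁻¹ ≤ B₁ / cu := by
    rw [le_div_iff₀ hcu, mul_comm]
    refine le_trans (le_of_eq ?_) hB.lower
    congr 4
    ring
  rw [← Real.rpow_le_rpow_iff (by norm_num) (by positivity) hq, Real.mul_rpow (by positivity) hD.le,
    needleHeight_rpow hcu hR hB.pos₁]
  have e : (32 * R) ^ ((m : ℝ) + 1 / 2) =
      (32 : ℝ) ^ ((m : ℝ) - 1 / 2) * 32 * (R ^ ((m : ℝ) - 1 / 2) * R) := by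
    rw [Real.mul_rpow (by norm_num) hR.le, show (m : ℝ) + 1 / 2 = ((m : ℝ) - 1 / 2) + 1 by ring,
      Real.rpow_add (by norm_num), Real.rpow_add hR, Real.rpow_one, Real.rpow_one]
  calc (3 : ℝ) ^ ((m : ℝ) + 1 / 2)
      = 32 * R * constC m ^ ((m : ℝ) - 1 / 2) *
        ((3 : ℝ) ^ ((m : ℝ) + 1 / 2) / 32 * constC m ^ (-((m : ℝ) - 1 / 2)) * R⁻¹) := by
        rw [Real.rpow_neg hC.le]
        have : constC m ^ ((m : ℝ) - 1 / 2) ≠ 0 := by positivity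
        field_simp
    _ ≤ 32 * R * constC m ^ ((m : ℝ) - 1 / 2) * (B₁ / cu) :=
        mul_le_mul_of_nonneg_left hlow (by positivity)
    _ = _ := by
        rw [e, Real.div_rpow hC.le (by norm_num), Real.rpow_neg hR.le]
        have h1 : R ^ ((m : ℝ) - 1 / 2) ≠ 0 := by positivity
        have h2 : (32 : ℝ) ^ ((m : ℝ) - 1 / 2) ≠ 0 := by positivity
        field_simp

/-- The definition of the height of the needles, in the form of the norm of a needle of width
`1 / (2 K)` with `K` replaced by `32 R D`. -/
lemma sq_radius_eq (hm : 0 < m) (hcu : 0 < cu) (hR : 0 < R) (hB₁ : 0 < B₁) :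
    (B₁ / cu) ^ 2 = needleHeight m cu R B₁ ^ 2 *
      (32 * R * needleHeight m cu R B₁ / constC m) ^ (2 * m - 1) := by
  have hC := constC_pos m
  have hD := needleHeight_pos (m := m) hcu hR hB₁
  have hpow := needleHeight_rpow (m := m) hcu hR hB₁
  set D := needleHeight m cu R B₁
  have h : B₁ / cu = D * (32 * R * D / constC m) ^ ((m : ℝ) - 1 / 2) := by
    rw [show (m : ℝ) + 1 / 2 = 1 + ((m : ℝ) - 1 / 2) by ring, Real.rpow_add hD, Real.rpow_one,
      Real.div_rpow hC.le (by norm_num), Real.rpow_neg hR.le] at hpow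
    rw [Real.div_rpow (by positivity) hC.le, Real.mul_rpow (by positivity) hD.le,
      Real.mul_rpow (by norm_num) hR.le]
    have h1 : R ^ ((m : ℝ) - 1 / 2) ≠ 0 := by positivity
    have h2 : (32 : ℝ) ^ ((m : ℝ) - 1 / 2) ≠ 0 := by positivity
    have h3 : constC m ^ ((m : ℝ) - 1 / 2) ≠ 0 := by positivity
    calc B₁ / cu = (constC m ^ ((m : ℝ) - 1 / 2) / 32 ^ ((m : ℝ) - 1 / 2) * (B₁ / cu) *
          (R ^ ((m : ℝ) - 1 / 2))⁻¹) * (32 ^ ((m : ℝ) - 1 / 2) * R ^ ((m : ℝ) - 1 / 2) /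
            constC m ^ ((m : ℝ) - 1 / 2)) := by field_simp
      _ = _ := by rw [← hpow]; ring
  rw [h, mul_pow]
  congr 1
  rw [← Real.rpow_natCast (_ ^ _), ← Real.rpow_mul (by positivity), ← Real.rpow_natCast,
    Nat.cast_sub (by omega)]
  congr 1
  push_cast
  ring

/-- The upper constraint on `B₁` says that the base reward lies in the ball of radius `B₂`. -/
lemma needleHeight_mul_le (hcu : 0 < cu) (hR : 0 < R) (hB : AdmissibleRadii m m₂ cu R B₁ B₂) :
    cu * (needleHeight m cu R B₁ * ((2 : ℝ) ^ (2 * (m₂ : ℝ) - 2) * (√(bumpEnergy m₂) / bumpMax))) ≤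
      B₂ := by
  have hC := constC_pos m
  have hC' := constC'_pos m m₂
  have hI := bumpEnergy_pos m₂
  have hM := bumpMax_pos
  have hB₁ := hB.pos₁
  have hD := needleHeight_pos (m := m) hcu hR hB.pos₁
  have hq : (0 : ℝ) < (m : ℝ) + 1 / 2 := by positivity
  have hpow := needleHeight_rpow (m := m) hcu hR hB.pos₁
  set D := needleHeight m cu R B₁
  set A := (2 : ℝ) ^ (2 * (m₂ : ℝ) - 2) * (√(bumpEnergy m₂) / bumpMax) with hA
  have hA0 : 0 < A := by positivity
  have hC'q : constC' m m₂ ^ ((m : ℝ) + 1 / 2) =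
      A ^ ((m : ℝ) + 1 / 2) * (constC m / 32) ^ ((m : ℝ) - 1 / 2) := by
    have : constC' m m₂ =
        A * (constC m / 32) ^ (((m : ℝ) - 1 / 2) / ((m : ℝ) + 1 / 2)) := by
      rw [constC', hA]; ring
    rw [this, Real.mul_rpow hA0.le (by positivity), ← Real.rpow_mul (by positivity),
      div_mul_cancel₀ _ hq.ne']
  rw [← Real.rpow_le_rpow_iff (by positivity) hB.pos₂.le hq, Real.mul_rpow hcu.le (by positivity),
    Real.mul_rpow hD.le hA0.le, hpow]
  have hup := hB.upper
  rw [Real.rpow_neg hC'.le, hC'q, show -(m : ℝ) + 1 / 2 = -((m : ℝ) - 1 / 2) by ring,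
    Real.rpow_neg hcu.le] at hup
  have e : cu ^ ((m : ℝ) + 1 / 2) = cu ^ ((m : ℝ) - 1 / 2) * cu := by
    rw [show (m : ℝ) + 1 / 2 = ((m : ℝ) - 1 / 2) + 1 by ring, Real.rpow_add hcu, Real.rpow_one]
  rw [e, Real.rpow_neg hR.le]
  have h1 : 0 < A ^ ((m : ℝ) + 1 / 2) := by positivity
  have h2 : 0 < (constC m / 32) ^ ((m : ℝ) - 1 / 2) := by positivity
  have h3 : 0 < cu ^ ((m : ℝ) - 1 / 2) := by positivity
  have h4 : 0 < R ^ ((m : ℝ) - 1 / 2) := by positivity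
  generalize A ^ ((m : ℝ) + 1 / 2) = x at *
  generalize (constC m / 32) ^ ((m : ℝ) - 1 / 2) = y at *
  generalize cu ^ ((m : ℝ) - 1 / 2) = z at *
  generalize R ^ ((m : ℝ) - 1 / 2) = w at *
  calc z * cu * (y * (B₁ / cu) * w⁻¹ * x) = (x * y * z * w⁻¹) * B₁ := by field_simp
    _ ≤ (x * y * z * w⁻¹) * ((x * y)⁻¹ * z⁻¹ * B₂ ^ ((m : ℝ) + 1 / 2) * w) :=
        mul_le_mul_of_nonneg_left hup (by positivity)
    _ = _ := by field_simp

lemma exists_admissibleRadii (m m₂ : ℕ) (hcu : 0 < cu) (hR : 0 < R) :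
    ∃ B₁ B₂ : ℝ, AdmissibleRadii m m₂ cu R B₁ B₂ := by
  have hC := constC_pos m
  have hC' := constC'_pos m m₂
  have hq : (m : ℝ) + 1 / 2 ≠ 0 := by positivity
  set B₁ := cu * ((3 : ℝ) ^ ((m : ℝ) + 1 / 2) / 32 * constC m ^ (-(m : ℝ) + 1 / 2) * R⁻¹) with hB₁
  have hB₁0 : 0 < B₁ := by positivity
  set x := constC' m m₂ ^ (-((m : ℝ) + 1 / 2)) * cu ^ (-(m : ℝ) + 1 / 2) * R ^ ((m : ℝ) - 1 / 2)
  have hx : 0 < x := by positivity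
  refine ⟨B₁, (B₁ / x) ^ (1 / ((m : ℝ) + 1 / 2)), hB₁0, by positivity, le_rfl, ?_⟩
  rw [← Real.rpow_mul (by positivity), div_mul_cancel₀ _ hq, Real.rpow_one, mul_right_comm]
  exact (mul_div_cancel₀ B₁ hx.ne').ge

end NeedleHeight

/-! ### The reward functions -/

/-- The base reward: a peak of height `D / 2` filling the right half of the interval. -/
noncomputable def baseReward (D : ℝ) : ℝ → ℝ := scaledBump (D / 2) (3 / 4) (1 / 4)

/-- The `i`-th of `K` needles of height `D` in the left half of the interval. -/
noncomputable def needle (D : ℝ) (K i : ℕ) : ℝ → ℝ :=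
  scaledBump D ((2 * i + 1) / (4 * K)) (1 / (4 * K))

lemma contDiff_baseReward (D : ℝ) : ContDiff ℝ ∞ (baseReward D) := contDiff_scaledBump _ _ _

lemma contDiff_needle (D : ℝ) (K i : ℕ) : ContDiff ℝ ∞ (needle D K i) := contDiff_scaledBump _ _ _

lemma baseReward_eq_zero {D x : ℝ} (hx : x ≤ 1 / 2 ∨ 1 ≤ x) : baseReward D x = 0 := by
  refine scaledBump_eq_zero (by norm_num) ?_
  rcases hx with hx | hx
  · rw [abs_of_nonpos] <;> linarith
  · rw [abs_of_nonneg] <;> linarith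

lemma needle_interval {K i : ℕ} (hi : i < K) :
    (0 : ℝ) < 1 / (4 * K) ∧ (0 : ℝ) ≤ (2 * i + 1) / (4 * K) - 1 / (4 * K) ∧
      ((2 * i + 1) / (4 * K) + 1 / (4 * K) : ℝ) ≤ 1 / 2 := by
  have hK : (0 : ℝ) < K := by exact_mod_cast (by omega : 0 < K)
  have hi' : (i : ℝ) + 1 ≤ K := by exact_mod_cast hi
  refine ⟨by positivity, ?_, ?_⟩
  · rw [← sub_div]; exact div_nonneg (by linarith [Nat.cast_nonneg (α := ℝ) i]) (by positivity)
  · rw [← add_div, div_le_div_iff₀ (by positivity) (by norm_num)]; linarith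

lemma needle_eq_zero {D x : ℝ} {K i : ℕ} (hi : i < K) (hx : x ≤ 0 ∨ 1 / 2 ≤ x) :
    needle D K i x = 0 := by
  obtain ⟨h0, h1, h2⟩ := needle_interval hi
  refine scaledBump_eq_zero h0 ?_
  rcases hx with hx | hx
  · rw [abs_of_nonpos] <;> linarith
  · rw [abs_of_nonneg] <;> linarith

lemma memSobolevZero_baseReward (D : ℝ) (m : ℕ) : MemSobolevZero m (baseReward D) :=
  memSobolevZero_of_contDiff (contDiff_baseReward D) (fun x hx => baseReward_eq_zero (by
    by_contra! h
    exact hx ⟨by linarith [h.1], h.2.le⟩)) m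

lemma memSobolevZero_baseReward_add_needle (D : ℝ) {K i : ℕ} (hi : i < K) (m : ℕ) :
    MemSobolevZero m (fun x => baseReward D x + needle D K i x) := by
  refine memSobolevZero_of_contDiff ((contDiff_baseReward D).add (contDiff_needle D K i))
    (fun x hx => ?_) m
  rcases not_and_or.1 hx with h | h
  · rw [baseReward_eq_zero (.inl (by linarith)), needle_eq_zero hi (.inl (by linarith)), add_zero]
  · rw [baseReward_eq_zero (.inr (by linarith)), needle_eq_zero hi (.inr (by linarith)), add_zero]

lemma sobolevSeminorm_baseReward {D : ℝ} (hD : 0 ≤ D) (m : ℕ) :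
    sobolevSeminorm m (baseReward D) =
      D * ((2 : ℝ) ^ (2 * (m : ℝ) - 2) * (√(bumpEnergy m) / bumpMax)) := by
  have hM := bumpMax_pos
  rw [sobolevSeminorm_eq (contDiff_baseReward D), baseReward,
    integral_iteratedDeriv_scaledBump_sq (by norm_num) (by norm_num) (by norm_num)]
  have e : (2 : ℝ) ^ (2 * (m : ℝ) - 2) = 4 ^ m / 4 := by
    rw [Real.rpow_sub (by norm_num), Real.rpow_mul (by norm_num), Real.rpow_natCast]
    norm_num
  rw [e, ← Real.sqrt_sq (show 0 ≤ D * (4 ^ m / 4 * (√(bumpEnergy m) / bumpMax)) by positivity)]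
  congr 1
  rw [mul_pow, mul_pow, div_pow (√_), Real.sq_sqrt (bumpEnergy_pos m).le, one_div, inv_inv]
  ring

lemma sobolevSeminorm_baseReward_add_needle_sq {m : ℕ} (hm : 0 < m) (D : ℝ) {K i : ℕ}
    (hi : i < K) :
    sobolevSeminorm m (fun x => baseReward D x + needle D K i x) ^ 2 =
      D ^ 2 * ((constC m)⁻¹ ^ (2 * m - 1) * (1 / 4 + (K : ℝ) ^ (2 * m - 1))) := by
  obtain ⟨h0, h1, h2⟩ := needle_interval hi
  have hK : (K : ℝ) ≠ 0 := by
    have : K ≠ 0 := by omega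
    exact_mod_cast this
  rw [sobolevSeminorm_eq ((contDiff_baseReward D).add (contDiff_needle D K i)),
    Real.sq_sqrt (integral_nonneg fun _ => sq_nonneg _),
    integral_iteratedDeriv_add_sq (contDiff_baseReward D) (contDiff_needle D K i), baseReward,
    needle, integral_iteratedDeriv_scaledBump_sq_eq_constC hm (by norm_num) (by norm_num) (by norm_num),
    integral_iteratedDeriv_scaledBump_sq_eq_constC hm h0 h1 (by linarith)]
  · have e : ((4 : ℝ) * (1 / (4 * K)))⁻¹ = K := by field_simp
    rw [e]
    norm_num
    rw [div_pow (K : ℝ)]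
    ring
  · -- the two supports only share the point `1/2`
    have hne : ∀ᵐ x ∂unitVolume, x ≠ 1 / 2 := by
      unfold unitVolume
      exact ae_restrict_of_ae (Measure.ae_ne volume _)
    refine hne.mono fun x hx => ?_
    rcases lt_or_gt_of_ne hx with hx | hx
    · rw [baseReward, iteratedDeriv_scaledBump_eq_zero (by norm_num), zero_mul]
      rw [abs_of_nonpos] <;> linarith
    · rw [needle, iteratedDeriv_scaledBump_eq_zero h0, mul_zero]
      rw [abs_of_nonneg] <;> linarith

/-! ### The lower bound on the regret -/

lemma Algorithm.expectedRegret_le_worstRegret (π : Algorithm) {H : Type*} [NormedAddCommGroup H]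
    [InnerProductSpace ℝ H] [RKHS ℝ H unitInterval ℝ] {B : ℝ} {S : Set (Measure ℝ)} {ξ : Measure ℝ}
    (hξ : ξ ∈ S) {f : H} (hf : ‖f‖ ≤ B) (T : ℕ) :
    ((π.expectedRegret f ξ T : ℝ) : EReal) ≤ π.worstRegret H B S T :=
  le_iSup₂_of_le f hf (le_iSup₂_of_le ξ hξ le_rfl)

/-- Adaptation to the smoother class costs linear regret on the rougher class. -/
lemma worstRegret_lower_bound {m₁ m₂ : ℕ} (hm₁ : 0 < m₁)
    {H₁ : Type*} [NormedAddCommGroup H₁] [InnerProductSpace ℝ H₁] [RKHS ℝ H₁ unitInterval ℝ]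
    {H₂ : Type*} [NormedAddCommGroup H₂] [InnerProductSpace ℝ H₂] [RKHS ℝ H₂ unitInterval ℝ]
    {cu : ℝ} (hcu : 0 < cu) (h₁ : IsNormEquivUpper H₁ m₁ cu) (h₂ : IsNormEquivUpper H₂ m₂ cu)
    {R : ℝ} (hR : 0 < R) {B₁ B₂ : ℝ} (hB : AdmissibleRadii m₁ m₂ cu R B₁ B₂)
    {S : Set (Measure ℝ)} (hS : gaussianReal 0 (1 / 4) ∈ S) (T : ℕ) (π : Algorithm)
    (hreg : π.worstRegret H₂ B₂ S T ≤ (R : EReal)) :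
    ((1 / 8 * needleHeight m₁ cu R B₁ * T : ℝ) : EReal) ≤ π.worstRegret H₁ B₁ S T := by
  have hC := constC_pos m₁
  have hD := needleHeight_pos (m := m₁) hcu hR hB.pos₁
  have h3 := three_le_needles hcu hR hB
  have hrad := sq_radius_eq hm₁ hcu hR hB.pos₁
  have hbase := needleHeight_mul_le hcu hR hB
  set D := needleHeight m₁ cu R B₁
  -- the number of needles; the `-1` leaves room in the ball for the base reward
  obtain ⟨K, hK⟩ : ∃ K, K + 1 = ⌊32 * R * D⌋₊ :=
    ⟨⌊32 * R * D⌋₊ - 1, Nat.sub_add_cancel (by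
      have : 3 ≤ ⌊32 * R * D⌋₊ := Nat.le_floor (by exact_mod_cast h3)
      omega)⟩
  have hK2 : 2 ≤ K := by
    have : 3 ≤ ⌊32 * R * D⌋₊ := Nat.le_floor (by exact_mod_cast h3)
    omega
  have hKle : (K : ℝ) + 1 ≤ 32 * R * D := by
    have := Nat.floor_le (show 0 ≤ 32 * R * D by positivity)
    rw [← hK] at this
    exact_mod_cast this
  have hKlt : 32 * R * D < (K : ℝ) + 2 := by
    have := Nat.lt_floor_add_one (32 * R * D)
    rw [← hK] at this
    push_cast at this
    linarith
  have hK2' : (2 : ℝ) ≤ K := by exact_mod_cast hK2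
  -- the base reward lies in the smooth ball
  obtain ⟨F, hF, hFn⟩ := h₂ (baseReward D) (contDiff_baseReward D).continuous.continuousOn
    (memSobolevZero_baseReward D m₂)
  have hFB : ‖F‖ ≤ B₂ := hFn.trans (by rw [sobolevSeminorm_baseReward hD.le]; exact hbase)
  have hF' : ⇑F = fun a : unitInterval => baseReward D a := funext hF
  have hregF := (π.expectedRegret_le_worstRegret hS hFB T).trans hreg
  rw [EReal.coe_le_coe_iff, hF'] at hregF
  have hmeas : ∀ {u : ℝ → ℝ}, ContDiff ℝ ∞ u → Measurable fun a : unitInterval => u a :=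
    fun hu => hu.continuous.measurable.comp measurable_subtype_coe
  obtain ⟨i, hi⟩ := π.exists_regret_ge hD hK2 (by linarith : 16 * R * D ≤ K)
    (hmeas (contDiff_baseReward D))
    (fun a => scaledBump_nonneg (by positivity) _ _ _) (fun a => scaledBump_le (by positivity) _ _ _)
    (fun a ha => baseReward_eq_zero (.inl ha))
    ⟨⟨3 / 4, by norm_num, by norm_num⟩, scaledBump_center _ _ _⟩
    (g := fun (i : Fin K) a => needle D K i a)
    (A := fun i => {a | |(a : ℝ) - (2 * (i : ℕ) + 1) / (4 * K)| < 1 / (4 * K)})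
    (fun i => hmeas (contDiff_needle D K i))
    (fun i a => scaledBump_nonneg hD.le _ _ _) (fun i a => scaledBump_le hD.le _ _ _)
    (fun i => measurableSet_lt (by fun_prop) measurable_const)
    (fun i j hij => by
      refine Set.disjoint_left.2 fun a hai haj => ?_
      simp only [mem_ofPred_eq, abs_lt] at hai haj
      have h4K : (0 : ℝ) < 4 * K := by positivity
      have e1 : ∀ n : ℕ, ((2 * n + 1) / (4 * K) - 1 / (4 * K) : ℝ) = 2 * n / (4 * K) := fun n => by
        ring
      have e2 : ∀ n : ℕ, ((2 * n + 1) / (4 * K) + 1 / (4 * K) : ℝ) = (2 * n + 2) / (4 * K) :=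
        fun n => by ring
      have l1 : (2 * (i : ℕ) / (4 * K) : ℝ) < (2 * (j : ℕ) + 2) / (4 * K) := by
        rw [← e1, ← e2]; linarith
      have l2 : (2 * (j : ℕ) / (4 * K) : ℝ) < (2 * (i : ℕ) + 2) / (4 * K) := by
        rw [← e1, ← e2]; linarith
      rw [div_lt_div_iff_of_pos_right h4K] at l1 l2
      have l1' : (i : ℕ) < j + 1 := by
        have : ((i : ℕ) : ℝ) < ((j : ℕ) : ℝ) + 1 := by linarith
        exact_mod_cast this
      have l2' : (j : ℕ) < i + 1 := by
        have : ((j : ℕ) : ℝ) < ((i : ℕ) : ℝ) + 1 := by linarith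
        exact_mod_cast this
      exact hij (Fin.ext (by omega)))
    (fun i a ha => by
      have := (needle_interval i.2).2.2
      have := (abs_lt.1 (show |(a : ℝ) - (2 * (i : ℕ) + 1) / (4 * K)| < 1 / (4 * K) from ha)).2
      linarith)
    (fun i a ha => scaledBump_eq_zero (needle_interval i.2).1 (not_lt.1 ha))
    (fun i => by
      obtain ⟨h0, h1, h2⟩ := needle_interval i.2
      exact ⟨⟨_, by linarith, by linarith⟩, scaledBump_center _ _ _⟩) T hregF
  -- the reward with the undetected needle lies in the rough ball
  obtain ⟨G, hG, hGn⟩ := h₁ (fun x => baseReward D x + needle D K i x)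
    ((contDiff_baseReward D).add (contDiff_needle D K i)).continuous.continuousOn
    (memSobolevZero_baseReward_add_needle D i.2 m₁)
  have hsemi : sobolevSeminorm m₁ (fun x => baseReward D x + needle D K i x) ≤ B₁ / cu := by
    -- `1/4 + K ^ n ≤ (K + 1) ^ n`, where `1/4` is the share of the base reward
    refine (pow_le_pow_iff_left₀ (sobolevSeminorm_nonneg _ _) (div_pos hB.pos₁ hcu).le
      (two_ne_zero (α := ℕ))).1 ?_
    rw [sobolevSeminorm_baseReward_add_needle_sq hm₁ D i.2, hrad, div_eq_inv_mul _ (constC m₁),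
      mul_pow (constC m₁)⁻¹]
    refine mul_le_mul_of_nonneg_left ?_ (by positivity)
    refine mul_le_mul_of_nonneg_left ?_ (by positivity)
    have hpow : (K : ℝ) ^ (2 * m₁ - 1) + 1 ^ (2 * m₁ - 1) ≤ ((K : ℝ) + 1) ^ (2 * m₁ - 1) :=
      pow_add_pow_le (Nat.cast_nonneg K) zero_le_one (by omega)
    rw [one_pow] at hpow
    have := pow_le_pow_left₀ (show (0 : ℝ) ≤ (K : ℝ) + 1 by positivity) hKle (2 * m₁ - 1)
    linarith
  have hGB : ‖G‖ ≤ B₁ := hGn.trans (by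
    rw [mul_comm]; exact (le_div_iff₀ hcu).1 hsemi)
  have hG' : ⇑G = fun a : unitInterval => baseReward D a + needle D K i a := funext hG
  refine le_trans ?_ (π.expectedRegret_le_worstRegret hS hGB T)
  rw [EReal.coe_le_coe_iff, hG']
  exact hi

end KernelBandit

theorem theorem1
    (m₁ m₂ : ℕ) (hm₁ : 0 < m₁) (hm : m₁ < m₂)
    (κ₁ κ₂ : ℝ → ℝ)
    (hκ₁ : KernelBandit.HasFourierDecay κ₁ m₁) (hκ₂ : KernelBandit.HasFourierDecay κ₂ m₂)
    (H₁ : Type*) [NormedAddCommGroup H₁] [InnerProductSpace ℝ H₁] [CompleteSpace H₁]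
    [RKHS ℝ H₁ unitInterval ℝ] (hH₁ : KernelBandit.IsRKHSOf H₁ κ₁)
    (H₂ : Type*) [NormedAddCommGroup H₂] [InnerProductSpace ℝ H₂] [CompleteSpace H₂]
    [RKHS ℝ H₂ unitInterval ℝ] (hH₂ : KernelBandit.IsRKHSOf H₂ κ₂) :
    (∃ cu : ℝ, 0 < cu ∧ KernelBandit.IsNormEquivUpper H₁ m₁ cu ∧
      KernelBandit.IsNormEquivUpper H₂ m₂ cu) ∧
    ∀ cu : ℝ, 0 < cu → KernelBandit.IsNormEquivUpper H₁ m₁ cu →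
      KernelBandit.IsNormEquivUpper H₂ m₂ cu →
    ∀ R : ℝ, 0 < R →
      (∃ B₁ B₂ : ℝ, KernelBandit.AdmissibleRadii m₁ m₂ cu R B₁ B₂) ∧
      ∀ B₁ B₂ : ℝ, KernelBandit.AdmissibleRadii m₁ m₂ cu R B₁ B₂ →
      ∀ S : Set (Measure ℝ), (∀ ξ ∈ S, KernelBandit.IsNoiseLaw ξ) → gaussianReal 0 (1 / 4) ∈ S →
      ∀ (T : ℕ) (π : KernelBandit.Algorithm),
        π.worstRegret H₂ B₂ S T ≤ (R : EReal) →
        ((1 / 8 * (KernelBandit.constC m₁ / 32) ^ (((m₁ : ℝ) - 1 / 2) / ((m₁ : ℝ) + 1 / 2)) *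
            (B₁ / cu) ^ (1 / ((m₁ : ℝ) + 1 / 2)) *
            R ^ (-(((m₁ : ℝ) - 1 / 2) / ((m₁ : ℝ) + 1 / 2))) * (T : ℝ) : ℝ) : EReal) ≤
          π.worstRegret H₁ B₁ S T := by
  constructor
  · obtain ⟨c₁, hc₁, h₁⟩ := KernelBandit.exists_isNormEquivUpper hm₁ hκ₁ H₁ hH₁
    obtain ⟨c₂, hc₂, h₂⟩ := KernelBandit.exists_isNormEquivUpper (hm₁.trans hm) hκ₂ H₂ hH₂
    exact ⟨max c₁ c₂, lt_max_of_lt_left hc₁, h₁.mono (le_max_left _ _), h₂.mono (le_max_right _ _)⟩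
  · intro cu hcu h₁ h₂ R hR
    refine ⟨KernelBandit.exists_admissibleRadii m₁ m₂ hcu hR, ?_⟩
    intro B₁ B₂ hB S _ hS T π hreg
    have h := KernelBandit.worstRegret_lower_bound hm₁ hcu h₁ h₂ hR hB hS T π hreg
    rwa [KernelBandit.needleHeight, ← mul_assoc, ← mul_assoc] at h
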